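/- **Theorem (Pre-shape derivative of the parameterization tracking problem).** Let $n\ge 1$ and let $M\subset\mathbb{R}^{n+1}$ be an $n$-dimensional, oriented, path-connected, compact $C^\infty$-submanifold, possibly with smooth boundary $\partial M$, with the Riemannian metric induced by $\mathbb{R}^{n+1}$. Let $\operatorname{Emb}_{\partial M}(M,\mathbb{R}^{n+1})$ be the set of injective smooth immersions $\varphi:M\to\mathbb{R}^{n+1}$ with $\varphi(p)=p$ for all $p\in\partial M$. For such $\varphi$ orient $\varphi(M)$ by means of $\varphi$, let $\mathrm{d}s$ be the $n$-dimensional surface measure, and for smooth oriented local orthonormal frames $\tau=(\tau_1,\dots,\tau_n)$ of $M$ and $\tau^\varphi=(\tau^\varphi_1,\dots,\tau^\varphi_n)$ of $\varphi(M)$ put $$D^\tau\varphi(p)=\big(\langle D\varphi\,\tau_j(p),\tau_i^\varphi(\varphi(p))\rangle\big)_{i,j=1}^n .$$ Let $g^M:M\to(0,\infty)$ be $C^\infty$, and for every $\varphi\in\operatorname{Emb}_{\partial M}(M,\mathbb{R}^{n+1})$ let $f_\varphi:\varphi(M)\to(0,\infty)$ be $C^\infty$, such that $f_{\varphi\circ\rho}=f_\varphi$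 whenever $\rho\in\operatorname{Diff}(M)$ and $\varphi,\varphi\circ\rho\in\operatorname{Emb}_{\partial M}(M,\mathbb{R}^{n+1})$, and $\int_{\varphi(M)}f_\varphi\,\mathrm{d}s=\int_M g^M\,\mathrm{d}s$ for all $\varphi$. Define $$\mathfrak{J}^\tau(\varphi)=\frac12\int_{\varphi(M)}\Big(g^M\circ\varphi^{-1}\cdot\frac{1}{\det D^\tau\varphi}\circ\varphi^{-1}-f_\varphi\Big)^2\,\mathrm{d}s ,$$ where at each point any local frames defined near it are used. Fix $\varphi\in\operatorname{Emb}_{\partial M}(M,\mathbb{R}^{n+1})$, and let $C^\infty_{\partial\varphi(M)}$ be the space of all $V\in C^\infty(\mathbb{R}^{n+1},\mathbb{R}^{n+1})$ with $V=0$ on $\partial\varphi(M)=\varphi(\partial M)$. For $t\ge0$ write $\varphi_t=\varphi+t\,V\circ\varphi$ and $x_t=x+tV(x)$. Assume that for every $V\in C^\infty_{\partial\varphi(M)}$ the material derivative $$\mathfrak{D}_m(f_\varphi)[V](x)=\frac{\mathrm{d}}{\mathrm{d}t}\Big|_{t=0^+}f_{\varphi_t}(x_t)$$ exists for all $x\in\varphi(M)$,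 and that the difference quotients $\frac1t\big(f_{\varphi_t}(x_t)-f_\varphi(x)\big)$ are bounded uniformly in $x\in\varphi(M)$ and in all sufficiently small $t>0$. Then the integral defining $\mathfrak{J}^\tau(\psi)$ converges for every $\psi\in\operatorname{Emb}_{\partial M}(M,\mathbb{R}^{n+1})$, and for every $V\in C^\infty_{\partial\varphi(M)}$ the map $\varphi_t$ belongs to $\operatorname{Emb}_{\partial M}(M,\mathbb{R}^{n+1})$ for all sufficiently small $t>0$, the integral below converges, and $$\begin{aligned}\mathfrak{D}\mathfrak{J}^\tau(\varphi)[V]:=\lim_{t\downarrow0}\frac{\mathfrak{J}^\tau(\varphi_t)-\mathfrak{J}^\tau(\varphi)}{t}=-\int_{\varphi(M)}&\frac12\Big(\big(g^M\circ\varphi^{-1}\cdot\tfrac{1}{\det D^\tau\varphi}\circ\varphi^{-1}\big)^2-f_\varphi^2\Big)\operatorname{div}_\Gamma(V)\\&+\Big(g^M\circ\varphi^{-1}\cdot\tfrac{1}{\det D^\tau\varphi}\circ\varphi^{-1}-f_\varphi\Big)\,\mathfrak{D}_m(f_\varphi)[V]\;\mathrm{d}s,\end{aligned}$$ where $\operatorname{div}_\Gamma(V)=\operatorname{tr}\big(DV(\mathrm{id}-\mathrm{n}\mathrm{n}^T)\big)$,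 with $\mathrm{n}$ a unit normal of $\varphi(M)$, is the tangential divergence on $\Gamma=\varphi(M)$. If moreover $V\mapsto\mathfrak{D}_m(f_\varphi)[V]$ is linear and bounded from $C^\infty_{\partial\varphi(M)}$, with the topology of uniform convergence of all derivatives on compact sets, into the bounded functions on $\varphi(M)$ with the supremum norm, then $V\mapsto\mathfrak{D}\mathfrak{J}^\tau(\varphi)[V]$ is a linear and bounded functional on $C^\infty_{\partial\varphi(M)}$. The pre-shape derivative does not depend on the choice of the oriented local orthonormal frames $\tau,\tau^\varphi$. -/

import Mathlib

open Set Filter Topology MeasureTheory Manifold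
open scoped ContDiff

noncomputable section

namespace PreShape

/-- The ambient Euclidean space `ℝ^{n+1}`. -/
abbrev Amb (n : ℕ) : Type := EuclideanSpace ℝ (Fin (n + 1))

variable {n : ℕ} [NeZero n] {M : Type*} [TopologicalSpace M]
  [ChartedSpace (EuclideanHalfSpace n) M]

/-- The differential `Dφ(p) : T_p M → ℝ^{n+1}` of a map `φ : M → ℝ^{n+1}` on the manifold with
boundary `M`. -/
def diffl (φ : M → Amb n) (p : M) : TangentSpace (𝓡∂ n) p →L[ℝ] Amb n :=
  mfderiv (𝓡∂ n) 𝓘(ℝ, Amb n) φ p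

/-- `φ ∈ Emb(M, ℝ^{n+1})`: an injective smooth map with injective differential everywhere. -/
structure IsEmb (φ : M → Amb n) : Prop where
  smooth : ContMDiff (𝓡∂ n) 𝓘(ℝ, Amb n) ∞ φ
  injective : Function.Injective φ
  immersion : ∀ p, Function.Injective (diffl φ p)

/-- `φ ∈ Emb_{∂M}(M, ℝ^{n+1})`: embeddings which leave the boundary of the submanifold `M` of
`ℝ^{n+1}` pointwise fixed. The submanifold is given by its inclusion `incl`. -/
structure IsEmbRel (incl φ : M → Amb n) : Prop extends IsEmb φ where
  boundary_fixed : ∀ p ∈ (𝓡∂ n).boundary M, φ p = incl p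

/-- The family `v` is a positively oriented basis of `T_p M` for the orientation `o` of `T_p M`. -/
def IsPositiveBasis {p : M} (o : Orientation ℝ (TangentSpace (𝓡∂ n) p) (Fin n))
    (v : Fin n → TangentSpace (𝓡∂ n) p) : Prop :=
  ∃ b : Module.Basis (Fin n) ℝ (TangentSpace (𝓡∂ n) p), (∀ i, b i = v i) ∧ b.orientation = o

/-- An orientation of the manifold `M`: a choice of orientations of all the tangent spaces, such
that every point has a neighbourhood carrying a smooth, positively oriented local frame. -/
def IsManifoldOrientation [IsManifold (𝓡∂ n) ∞ M]
    (o : ∀ p : M, Orientation ℝ (TangentSpace (𝓡∂ n) p) (Fin n)) : Prop :=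
  ∀ p : M, ∃ U : Set M, IsOpen U ∧ p ∈ U ∧
    ∃ X : Fin n → ∀ q : M, TangentSpace (𝓡∂ n) q,
      IsLocalFrameOn (𝓡∂ n) (EuclideanSpace ℝ (Fin n)) ∞ X U ∧
      ∀ q ∈ U, IsPositiveBasis (o q) (fun i => X i q)

/-- `τ = (τ_1, …, τ_n)` is, on some neighbourhood of `p`, a smooth oriented local orthonormal frame
of `M`, where `M` carries the Riemannian metric induced by the inclusion `incl`. -/
def IsOrientedFrameNear [IsManifold (𝓡∂ n) ∞ M] (incl : M → Amb n)
    (o : ∀ p : M, Orientation ℝ (TangentSpace (𝓡∂ n) p) (Fin n)) (p : M)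
    (τ : Fin n → ∀ q : M, TangentSpace (𝓡∂ n) q) : Prop :=
  ∃ U : Set M, IsOpen U ∧ p ∈ U ∧
    IsLocalFrameOn (𝓡∂ n) (EuclideanSpace ℝ (Fin n)) ∞ τ U ∧
    ∀ q ∈ U, Orthonormal ℝ (fun i => diffl incl q (τ i q)) ∧
      IsPositiveBasis (o q) (fun i => τ i q)

/-- `σ = (σ_1, …, σ_n)` is, on a neighbourhood `φ(U)` of `φ(p)` in the shape `φ(M)`, a smooth
oriented local orthonormal frame of `φ(M) ⊆ ℝ^{n+1}`. Its members are vectors of `ℝ^{n+1}`, and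
`φ(M)` is oriented by `φ`: the `Dφ(q)`-image of a positive basis of `T_q M` is positive. -/
def IsOrientedShapeFrameNear (φ : M → Amb n)
    (o : ∀ p : M, Orientation ℝ (TangentSpace (𝓡∂ n) p) (Fin n)) (p : M)
    (σ : Fin n → Amb n → Amb n) : Prop :=
  ∃ U : Set M, IsOpen U ∧ p ∈ U ∧
    (∀ i, ContMDiffOn (𝓡∂ n) 𝓘(ℝ, Amb n) ∞ (fun q => σ i (φ q)) U) ∧
    ∀ q ∈ U, Orthonormal ℝ (fun i => σ i (φ q)) ∧
      ∃ v : Fin n → TangentSpace (𝓡∂ n) q,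
        IsPositiveBasis (o q) v ∧ ∀ i, diffl φ q (v i) = σ i (φ q)

/-- The matrix `D^τ φ(p) = (⟨Dφ τ_j(p), σ_i(φ(p))⟩)_{i,j}` of the covariant derivative of `φ` with
respect to the local frames `τ` of `M` and `σ` of `φ(M)`. -/
def covDeriv (φ : M → Amb n) (τ : Fin n → ∀ q : M, TangentSpace (𝓡∂ n) q)
    (σ : Fin n → Amb n → Amb n) (p : M) : Matrix (Fin n) (Fin n) ℝ :=
  Matrix.of fun i j => inner ℝ (diffl φ p (τ j p)) (σ i (φ p))

/-- The function `(g ∘ φ⁻¹) · (1 / det D^τ φ) ∘ φ⁻¹` on `φ(M)`. Here `τ p` and `σ p` are the local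
frames which are used at the point `p ∈ M` and at the point `φ(p) ∈ φ(M)`. -/
def density [Nonempty M] (g : M → ℝ) (φ : M → Amb n)
    (τ : M → Fin n → ∀ q : M, TangentSpace (𝓡∂ n) q) (σ : M → Fin n → Amb n → Amb n)
    (s : Amb n) : ℝ :=
  let p := Function.invFun φ s
  g p * (1 / (covDeriv φ (τ p) (σ p) p).det)

/-- The integrand of the tracking functional at `φ`. -/
def trackingIntegrand [Nonempty M] (g : M → ℝ) (f : (M → Amb n) → Amb n → ℝ)
    (τ : M → Fin n → ∀ q : M, TangentSpace (𝓡∂ n) q)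
    (σ : (M → Amb n) → M → Fin n → Amb n → Amb n) (φ : M → Amb n) (s : Amb n) : ℝ :=
  (density g φ τ (σ φ) s - f φ s) ^ 2

/-- The tracking functional
`𝔍^τ(φ) = 1/2 ∫_{φ(M)} (g ∘ φ⁻¹ · (1 / det D^τ φ) ∘ φ⁻¹ - f_φ)² ds`. The surface measure `ds` on
`φ(M)` is the normalised `n`-dimensional Hausdorff measure of `ℝ^{n+1}`. -/
def trackingFunctional [Nonempty M] (g : M → ℝ) (f : (M → Amb n) → Amb n → ℝ)
    (τ : M → Fin n → ∀ q : M, TangentSpace (𝓡∂ n) q)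
    (σ : (M → Amb n) → M → Fin n → Amb n → Amb n) (φ : M → Amb n) : ℝ :=
  (1 / 2) * ∫ s in range φ, trackingIntegrand g f τ σ φ s ∂(μHE[n] : Measure (Amb n))

/-- The perturbation of identity `φ_t = φ + t • V ∘ φ`. -/
def perturb (φ : M → Amb n) (V : Amb n → Amb n) (t : ℝ) : M → Amb n :=
  fun p => φ p + t • V (φ p)

/-- The directions `C^∞_{∂φ(M)}(ℝ^{n+1}, ℝ^{n+1})`: smooth vector fields vanishing on the boundary
`∂φ(M) = φ(∂M)`. -/
def directions (φ : M → Amb n) : Submodule ℝ (Amb n → Amb n) where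
  carrier := {V | ContDiff ℝ ∞ V ∧ ∀ p ∈ (𝓡∂ n).boundary M, V (φ p) = 0}
  zero_mem' := ⟨contDiff_const, fun _ _ => rfl⟩
  add_mem' := fun hV hW => ⟨hV.1.add hW.1, fun p hp => by simp [hV.2 p hp, hW.2 p hp]⟩
  smul_mem' := fun c _ hV => ⟨contDiff_const.smul hV.1, fun p hp => by simp [hV.2 p hp]⟩

/-- The pre-shape material derivative
`𝔇_m f(φ)[V](x) = d/dt|_{t=0} f_{φ_t}(x + t V(x))`, with `t ≥ 0`. -/
def materialDeriv (f : (M → Amb n) → Amb n → ℝ) (φ : M → Amb n) (V : Amb n → Amb n)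
    (x : Amb n) : ℝ :=
  derivWithin (fun t : ℝ => f (perturb φ V t) (x + t • V x)) (Ici 0) 0

/-- The material derivative of `f` at `φ` in direction `V` exists at every point of `φ(M)`, and its
difference quotients are bounded, uniformly on `φ(M)`, for small `t > 0`. -/
structure HasMaterialDeriv (f : (M → Amb n) → Amb n → ℝ) (φ : M → Amb n)
    (V : Amb n → Amb n) : Prop where
  exists_at : ∀ x ∈ range φ,
    DifferentiableWithinAt ℝ (fun t : ℝ => f (perturb φ V t) (x + t • V x)) (Ici 0) 0
  bounded : ∃ C : ℝ, ∀ᶠ t in 𝓝[>] (0 : ℝ), ∀ x ∈ range φ,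
    |f (perturb φ V t) (x + t • V x) - f φ x| ≤ C * t

/-- The tangent space of `φ(M)` at the point `x ∈ φ(M)`, as a subspace of `ℝ^{n+1}`. -/
def shapeTangent [Nonempty M] (φ : M → Amb n) (x : Amb n) : Submodule ℝ (Amb n) :=
  (diffl φ (Function.invFun φ x)).range

/-- The tangential divergence `div_Γ V = tr (DV ∘ P)` on `Γ = φ(M)`, where `P = id - n nᵀ` is the
orthogonal projection to the tangent space of `φ(M)`. -/
def tangentialDiv [Nonempty M] (φ : M → Amb n) (V : Amb n → Amb n) (x : Amb n) : ℝ :=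
  LinearMap.trace ℝ (Amb n)
    (((fderiv ℝ V x) ∘L (shapeTangent φ x).starProjection : Amb n →L[ℝ] Amb n) :
      Amb n →ₗ[ℝ] Amb n)

/-- The integrand of the formula for the pre-shape derivative of the tracking functional. -/
def derivIntegrand [Nonempty M] (g : M → ℝ) (f : (M → Amb n) → Amb n → ℝ)
    (τ : M → Fin n → ∀ q : M, TangentSpace (𝓡∂ n) q)
    (σ : (M → Amb n) → M → Fin n → Amb n → Amb n) (φ : M → Amb n) (V : Amb n → Amb n)
    (s : Amb n) : ℝ :=
  (1 / 2) * ((density g φ τ (σ φ) s) ^ 2 - (f φ s) ^ 2) * tangentialDiv φ V s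
    + (density g φ τ (σ φ) s - f φ s) * materialDeriv f φ V s

/-- The closed formula for the pre-shape derivative of the tracking functional. -/
def derivFormula [Nonempty M] (g : M → ℝ) (f : (M → Amb n) → Amb n → ℝ)
    (τ : M → Fin n → ∀ q : M, TangentSpace (𝓡∂ n) q)
    (σ : (M → Amb n) → M → Fin n → Amb n → Amb n) (φ : M → Amb n) (V : Amb n → Amb n) : ℝ :=
  - ∫ s in range φ, derivIntegrand g f τ σ φ V s ∂(μHE[n] : Measure (Amb n))

/-- `L` is the one-sided directional derivative of the pre-shape functional `J` at `φ` in direction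
`V`, that is `(J(φ_t) - J(φ)) / t → L` as `t ↓ 0`. The perturbed maps `φ_t` are required to be
pre-shapes for small `t > 0`. -/
def HasDirectionalDeriv (incl : M → Amb n) (J : (M → Amb n) → ℝ) (φ : M → Amb n)
    (V : Amb n → Amb n) (L : ℝ) : Prop :=
  (∀ᶠ t in 𝓝[>] (0 : ℝ), IsEmbRel incl (perturb φ V t)) ∧
    Tendsto (fun t : ℝ => (J (perturb φ V t) - J φ) / t) (𝓝[>] 0) (𝓝 L)

/-- `L`, from a space `A` of smooth vector fields to real functions on `X` with the supremum norm,
is linear and bounded for the topology of `C^∞(ℝ^{n+1}, ℝ^{n+1})`, which is given by the suprema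
over compact sets of the derivatives. For `X` a point this says that a functional is linear and
bounded. -/
def IsBoundedLinear {X : Type*} (A : Submodule ℝ (Amb n → Amb n))
    (L : (Amb n → Amb n) → X → ℝ) : Prop :=
  IsLinearMap ℝ (fun V : A => L V) ∧
    ∃ (K : Set (Amb n)) (k : ℕ) (C : ℝ), IsCompact K ∧ ∀ V ∈ A, ∀ B : ℝ, 0 ≤ B →
      (∀ j ≤ k, ∀ x ∈ K, ‖iteratedFDeriv ℝ j V x‖ ≤ B) → ∀ x : X, |L V x| ≤ C * B

end PreShape

end

/-! The proof pulls everything back to `M` with one fixed measure, the surface measure of `φ`. Call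
`relJac φ ψ` the quotient of the volume densities induced by `ψ` and by `φ`. Three facts carry the
argument.

Since all frames are orthonormal and positively oriented, `det D^τ ψ` is exactly `relJac incl ψ`
(`det_covDeriv_eq_relJac`). Frames disappear from the density, which gives independence of their
choice.

The area formula `IsEmb.surfaceMeasure_eq_withDensity` says that the surface measure of `ψ` has
density `relJac φ ψ` with respect to that of `φ`. Near a point both embeddings are almost isometric
to linear maps in the same chart, and linear maps scale volume by `normDet`. With the chain rule for
`relJac`, the functional becomes `1/2 ∫ (ρ / r - F)² r`, where `ρ` is the density of `φ`, `r =
relJac φ ψ` and `F = f_ψ ∘ ψ`.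

Along `φ_t` the factor `r` is the volume stretch of `id + t DV` on the tangent space. It is the root
of a Gram determinant, equals 1 at `t = 0`, and has derivative `div_Γ V` there
(`hasDerivAt_stretch`). Differentiating the integrand gives `-2` times the claimed one. The stretch
is Lipschitz at `t = 0` uniformly on `M`, and the difference quotients of `f` are bounded by
hypothesis, so dominated convergence on a finite measure moves the limit inside the integral. -/

noncomputable section

namespace PreShape

open scoped NNReal ENNReal InnerProductSpace

/-! ### Volume factors of linear maps -/

section NormDet

variable {U V : Type*} [NormedAddCommGroup U] [InnerProductSpace ℝ U] [FiniteDimensional ℝ U]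
  [NormedAddCommGroup V] [InnerProductSpace ℝ V]

theorem normDet_eq_sqrt_det [CompleteSpace U] [CompleteSpace V] (B : U →L[ℝ] V) :
    LinearMap.normDet (B : U →ₗ[ℝ] V) = √((B.adjoint ∘L B).det) := by
  have h := B.normDet_sq
  simp only [RCLike.ofReal_real_eq_id, id_eq] at h
  rw [← h, Real.sqrt_sq (LinearMap.normDet_nonneg _)]

theorem continuous_normDet [CompleteSpace U] [CompleteSpace V] :
    Continuous fun B : U →L[ℝ] V => LinearMap.normDet (B : U →ₗ[ℝ] V) := by
  simp_rw [normDet_eq_sqrt_det]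
  refine Real.continuous_sqrt.comp (ContinuousLinearMap.continuous_det.comp ?_)
  exact ((ContinuousLinearMap.adjoint (𝕜 := ℝ) (E := U) (F := V)).continuous).clm_comp continuous_id

theorem normDet_pos {B : U →ₗ[ℝ] V} (hB : Function.Injective B) : 0 < B.normDet := by
  refine lt_of_le_of_ne B.normDet_nonneg fun h => ?_
  exact (LinearMap.normDet_eq_zero_iff_ker_ne_bot.mp h.symm) (LinearMap.ker_eq_bot.mpr hB)

theorem normDet_comp_endo (B : U →ₗ[ℝ] V) (T : U →ₗ[ℝ] U) :
    (B ∘ₗ T).normDet = B.normDet * |LinearMap.det T| := by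
  rw [LinearMap.normDet_comp_of_finrank_eq _ _ rfl, LinearMap.normDet_eq_abs_det]

/-- An injective linear map is a linear isometry after an automorphism of its domain. -/
theorem exists_linearIsometry_comp_eq (B : U →ₗ[ℝ] V) (hB : Function.Injective B) :
    ∃ (ι : U →ₗᵢ[ℝ] V) (T : U →ₗ[ℝ] U), B = ι.toLinearMap ∘ₗ T ∧
      LinearMap.range ι.toLinearMap = LinearMap.range B := by
  have hr : Module.finrank ℝ U = Module.finrank ℝ (LinearMap.range B) :=
    (LinearMap.finrank_range_of_inj hB).symm
  -- Domain and range have equal dimension, so some linear isometry joins them; `T` is `B` read back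
  -- through it.
  let e : U ≃ₗᵢ[ℝ] LinearMap.range B :=
    (stdOrthonormalBasis ℝ U).equiv (stdOrthonormalBasis ℝ (LinearMap.range B)) (finCongr hr)
  refine ⟨(LinearMap.range B).subtypeₗᵢ.comp e.toLinearIsometry,
    e.symm.toLinearEquiv.toLinearMap ∘ₗ B.rangeRestrict, ?_, ?_⟩
  · ext x; simp
  · ext x
    constructor
    · rintro ⟨y, rfl⟩
      exact (e y).2
    · intro hx
      exact ⟨e.symm ⟨x, hx⟩, by simp⟩

end NormDet

/-! ### The derivative of the determinant at the identity -/

section DetDeriv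

variable {U : Type*} [NormedAddCommGroup U] [InnerProductSpace ℝ U]

theorem det_eq_sum_perm (b : OrthonormalBasis (Fin (Module.finrank ℝ U)) ℝ U) (Z : U →L[ℝ] U) :
    Z.det = ∑ s : Equiv.Perm (Fin (Module.finrank ℝ U)),
      ((Equiv.Perm.sign s : ℤ) : ℝ) * ∏ i, ⟪b (s i), Z (b i)⟫_ℝ := by
  rw [ContinuousLinearMap.det, ← LinearMap.det_toMatrix b.toBasis, Matrix.det_apply']
  simp [LinearMap.toMatrix_apply, OrthonormalBasis.repr_apply_apply]

variable [FiniteDimensional ℝ U]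

theorem differentiable_det : Differentiable ℝ fun Z : U →L[ℝ] U => Z.det := by
  simp_rw [det_eq_sum_perm (stdOrthonormalBasis ℝ U)]
  refine Differentiable.fun_sum fun s _ => Differentiable.const_mul (fun Z => ?_) _
  exact (HasFDerivAt.finsetProd (u := Finset.univ) (x := Z)
    (g := fun i (Z : U →L[ℝ] U) => ⟪stdOrthonormalBasis ℝ U (s i), Z (stdOrthonormalBasis ℝ U i)⟫_ℝ)
    (fun i _ => (innerSL ℝ (stdOrthonormalBasis ℝ U (s i)) ∘L
      ContinuousLinearMap.apply ℝ U (stdOrthonormalBasis ℝ U i)).hasFDerivAt)).differentiableAt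

theorem hasDerivAt_det_one_add_smul (X : U →L[ℝ] U) :
    HasDerivAt (fun t : ℝ => ContinuousLinearMap.det (1 + t • X))
      (LinearMap.trace ℝ U (X : U →ₗ[ℝ] U)) 0 := by
  let b := (stdOrthonormalBasis ℝ U).toBasis
  have h : ∀ t : ℝ, ContinuousLinearMap.det (1 + t • X) =
      Matrix.det (1 + t • LinearMap.toMatrix b b (X : U →ₗ[ℝ] U)) := by
    intro t
    rw [ContinuousLinearMap.det, ← LinearMap.det_toMatrix b]
    congr 1
    simp [map_add, LinearMap.toMatrix_one]
  rw [funext fun t => (h t).trans (Matrix.det_one_add_smul t _)]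
  rw [LinearMap.trace_eq_matrix_trace ℝ b]
  -- Only the linear coefficient matters: the polynomial remainder `P` carries the factor `t²`.
  generalize Matrix.trace (LinearMap.toMatrix b b (X : U →ₗ[ℝ] U)) = c
  generalize (Matrix.det (1 + (Polynomial.X : Polynomial ℝ) •
    (LinearMap.toMatrix b b (X : U →ₗ[ℝ] U)).map Polynomial.C)).divX.divX = P
  have h1 := ((hasDerivAt_const (0 : ℝ) (1 : ℝ)).fun_add
    ((hasDerivAt_id' (0 : ℝ)).const_mul c)).fun_add
    ((P.hasDerivAt 0).fun_mul (hasDerivAt_pow 2 (0 : ℝ)))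
  exact h1.congr_deriv (by simp)

/-- Differentiability being known, the derivative can be read off along the line `1 + t X`. -/
theorem fderiv_det_one (X : U →L[ℝ] U) :
    fderiv ℝ (fun Z : U →L[ℝ] U => Z.det) 1 X = LinearMap.trace ℝ U (X : U →ₗ[ℝ] U) := by
  have h1 : HasDerivAt (fun t : ℝ => (1 : U →L[ℝ] U) + t • X) X 0 := by
    simpa using ((hasDerivAt_id (0 : ℝ)).smul_const X).const_add (1 : U →L[ℝ] U)
  have h2 : HasFDerivAt (fun Z : U →L[ℝ] U => Z.det)
      (fderiv ℝ (fun Z : U →L[ℝ] U => Z.det) 1) ((fun t : ℝ => (1 : U →L[ℝ] U) + t • X) 0) := by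
    simpa using (differentiable_det (U := U) 1).hasFDerivAt
  have h3 := h2.comp_hasDerivAt 0 h1
  exact h3.unique (hasDerivAt_det_one_add_smul X)

theorem differentiableAt_sqrt_det_one :
    DifferentiableAt ℝ (fun Z : U →L[ℝ] U => √Z.det) 1 :=
  (differentiable_det (U := U) 1).sqrt (by simp [ContinuousLinearMap.det])

end DetDeriv

/-! ### Volume stretch under a perturbation of the identity -/

section Stretch

variable {U V : Type*} [NormedAddCommGroup U] [InnerProductSpace ℝ U] [FiniteDimensional ℝ U]
  [NormedAddCommGroup V] [InnerProductSpace ℝ V] [FiniteDimensional ℝ V]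

/-- The factor by which the perturbation `id + t L` of the identity stretches the volume of the
range of `B`. -/
def stretch (B : U →L[ℝ] V) (L : V →L[ℝ] V) (t : ℝ) : ℝ :=
  LinearMap.normDet (((1 + t • L) ∘L B : U →L[ℝ] V) : U →ₗ[ℝ] V) /
    LinearMap.normDet (B : U →ₗ[ℝ] V)

/-- Factor `B = ι T` with `ι` isometric. Then `|det T|` cancels from the quotient and the Gram
determinant of `(1 + t L) ι` remains, where `ι* ι = 1`. Only the range of `B` matters, which makes
estimates uniform in `B`. -/
theorem stretch_eq_sqrt_det (B : U →L[ℝ] V) (hB : Function.Injective B) :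
    ∃ ι : U →ₗᵢ[ℝ] V, LinearMap.range ι.toLinearMap = LinearMap.range (B : U →ₗ[ℝ] V) ∧
      ∀ (L : V →L[ℝ] V) (t : ℝ), stretch B L t =
        haveI : CompleteSpace U := FiniteDimensional.complete ℝ U
        haveI : CompleteSpace V := FiniteDimensional.complete ℝ V
        √(ContinuousLinearMap.det (1 + (t • (ι.toContinuousLinearMap.adjoint ∘L
          (L + L.adjoint) ∘L ι.toContinuousLinearMap) + t ^ 2 •
          (ι.toContinuousLinearMap.adjoint ∘L (L.adjoint ∘L L) ∘L ι.toContinuousLinearMap)))) := by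
  have : CompleteSpace U := FiniteDimensional.complete ℝ U
  have : CompleteSpace V := FiniteDimensional.complete ℝ V
  obtain ⟨ι, T, hT, hr⟩ := exists_linearIsometry_comp_eq (B : U →ₗ[ℝ] V) hB
  refine ⟨ι, hr, fun L t => ?_⟩
  have hpos := normDet_pos (B := (B : U →ₗ[ℝ] V)) hB
  have h1 : (((1 + t • L) ∘L B : U →L[ℝ] V) : U →ₗ[ℝ] V) =
      (((1 + t • L) ∘L ι.toContinuousLinearMap : U →L[ℝ] V) : U →ₗ[ℝ] V) ∘ₗ T := by
    ext x
    have := LinearMap.congr_fun hT x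
    simp only [ContinuousLinearMap.coe_coe, LinearMap.comp_apply] at this
    simp [this]
  have h2 : LinearMap.normDet (B : U →ₗ[ℝ] V) = |LinearMap.det T| := by
    rw [hT, normDet_comp_endo, ι.normDet_eq_one, one_mul]
  rw [stretch, h1, normDet_comp_endo, h2, mul_div_assoc, div_self (h2 ▸ hpos.ne'), mul_one,
    normDet_eq_sqrt_det]
  congr 2
  ext x
  refine ext_inner_left ℝ fun y => ?_
  simp [inner_add_right, ContinuousLinearMap.adjoint_inner_right, inner_smul_right]
  ring

/-- `ι ι*` is the orthogonal projection onto the range, so cyclicity turns the trace of `ι* L ι`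
into that of `L P`. The adjoint has the same trace, whence the factor 2. -/
theorem trace_adjoint_comp (ι : U →ₗᵢ[ℝ] V) (L : V →L[ℝ] V) (S : Submodule ℝ V)
    (hS : LinearMap.range ι.toLinearMap = S) :
    haveI : CompleteSpace U := FiniteDimensional.complete ℝ U
    haveI : CompleteSpace V := FiniteDimensional.complete ℝ V
    LinearMap.trace ℝ U ((ι.toContinuousLinearMap.adjoint ∘L
      (L + L.adjoint) ∘L ι.toContinuousLinearMap : U →L[ℝ] U) : U →ₗ[ℝ] U) =
    2 * LinearMap.trace ℝ V ((L ∘L S.starProjection : V →L[ℝ] V) : V →ₗ[ℝ] V) := by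
  have : CompleteSpace U := FiniteDimensional.complete ℝ U
  have : CompleteSpace V := FiniteDimensional.complete ℝ V
  subst hS
  have hP : ∀ x, (LinearMap.range ι.toLinearMap).starProjection x =
      ι (ι.toContinuousLinearMap.adjoint x) := by
    intro x
    refine Submodule.eq_starProjection_of_mem_of_inner_eq_zero
      (LinearMap.mem_range_self ι.toLinearMap _) ?_
    rintro _ ⟨y, rfl⟩
    have h := ContinuousLinearMap.adjoint_inner_left ι.toContinuousLinearMap y x
    have h' := ι.inner_map_map (ι.toContinuousLinearMap.adjoint x) y
    rw [inner_sub_left]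
    simp only [LinearIsometry.coe_toContinuousLinearMap, LinearIsometry.coe_toLinearMap] at *
    rw [h', h, sub_self]
  have h1 : LinearMap.trace ℝ U ((ι.toContinuousLinearMap.adjoint ∘L L ∘L
      ι.toContinuousLinearMap : U →L[ℝ] U) : U →ₗ[ℝ] U) =
      LinearMap.trace ℝ V ((L ∘L (LinearMap.range ι.toLinearMap).starProjection : V →L[ℝ] V) :
        V →ₗ[ℝ] V) := by
    have h3 := LinearMap.trace_comp_comm' ((ι.toContinuousLinearMap.adjoint : V →L[ℝ] U) :
      V →ₗ[ℝ] U) ((L ∘L ι.toContinuousLinearMap : U →L[ℝ] V) : U →ₗ[ℝ] V)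
    refine h3.symm.trans ?_
    congr 1
    ext x
    simp [hP]
  have h2 : LinearMap.trace ℝ U ((ι.toContinuousLinearMap.adjoint ∘L L.adjoint ∘L
      ι.toContinuousLinearMap : U →L[ℝ] U) : U →ₗ[ℝ] U) =
      LinearMap.trace ℝ U ((ι.toContinuousLinearMap.adjoint ∘L L ∘L
      ι.toContinuousLinearMap : U →L[ℝ] U) : U →ₗ[ℝ] U) := by
    rw [LinearMap.trace_eq_sum_inner _ (stdOrthonormalBasis ℝ U),
      LinearMap.trace_eq_sum_inner _ (stdOrthonormalBasis ℝ U)]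
    refine Finset.sum_congr rfl fun i _ => ?_
    simp only [ContinuousLinearMap.coe_coe, ContinuousLinearMap.comp_apply,
      ContinuousLinearMap.adjoint_inner_right]
    rw [real_inner_comm]
  rw [← h1, two_mul]
  nth_rewrite 2 [← h2]
  rw [← map_add]
  congr 1
  ext x
  simp

/-- The `t²` term does not contribute at 0, and the square root halves the trace, cancelling the 2
of `trace_adjoint_comp`. -/
theorem hasDerivAt_stretch (B : U →L[ℝ] V) (hB : Function.Injective B) (L : V →L[ℝ] V) :
    HasDerivAt (stretch B L) (LinearMap.trace ℝ V
      ((L ∘L (LinearMap.range (B : U →ₗ[ℝ] V)).starProjection : V →L[ℝ] V) : V →ₗ[ℝ] V)) 0 := by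
  have : CompleteSpace U := FiniteDimensional.complete ℝ U
  have : CompleteSpace V := FiniteDimensional.complete ℝ V
  obtain ⟨ι, hr, h⟩ := stretch_eq_sqrt_det B hB
  rw [funext (h L)]
  have ht := trace_adjoint_comp ι L _ hr
  set X := ι.toContinuousLinearMap.adjoint ∘L (L + L.adjoint) ∘L ι.toContinuousLinearMap
  set Y := ι.toContinuousLinearMap.adjoint ∘L (L.adjoint ∘L L) ∘L ι.toContinuousLinearMap
  have hZ : HasDerivAt (fun t : ℝ => (1 : U →L[ℝ] U) + (t • X + t ^ 2 • Y)) X 0 := by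
    have := (((hasDerivAt_id (0 : ℝ)).smul_const X).add
      ((hasDerivAt_pow 2 (0 : ℝ)).smul_const Y)).const_add (1 : U →L[ℝ] U)
    simpa using this
  have hd : HasFDerivAt (fun Z : U →L[ℝ] U => Z.det)
      (fderiv ℝ (fun Z : U →L[ℝ] U => Z.det) 1)
      ((fun t : ℝ => (1 : U →L[ℝ] U) + (t • X + t ^ 2 • Y)) 0) := by
    simpa using (differentiable_det (U := U) 1).hasFDerivAt
  have h1 := (hd.comp_hasDerivAt 0 hZ).sqrt (by simp [ContinuousLinearMap.det])
  convert! h1 using 1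
  rw [fderiv_det_one, ht]
  simp [ContinuousLinearMap.det]

variable (U V) in
/-- The stretch factor is Lipschitz at `0`, uniformly for bounded perturbations. -/
theorem exists_abs_stretch_sub_one_le (Λ : ℝ) (hΛ : 0 ≤ Λ) :
    ∃ K δ : ℝ, 0 ≤ K ∧ 0 < δ ∧ ∀ (B : U →L[ℝ] V), Function.Injective B → ∀ L : V →L[ℝ] V,
      ‖L‖ ≤ Λ → ∀ t : ℝ, 0 ≤ t → t ≤ δ → |stretch B L t - 1| ≤ K * t := by
  have : CompleteSpace U := FiniteDimensional.complete ℝ U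
  have : CompleteSpace V := FiniteDimensional.complete ℝ V
  -- Differentiability of `√det` at 1 gives a Lipschitz estimate at 1 on a ball which depends on
  -- neither `B` nor `L`.
  obtain ⟨C, hC, hO⟩ := (differentiableAt_sqrt_det_one (U := U)).hasFDerivAt.isBigO_sub.exists_nonneg
  rw [Asymptotics.IsBigOWith] at hO
  obtain ⟨ε, hε, hball⟩ := Metric.eventually_nhds_iff.mp hO
  -- For `t ≤ 1` the perturbation of 1 has norm at most `t A`; the summand 1 keeps `A` positive, and
  -- `t ≤ ε / (2 A)` keeps the perturbation inside the ball.
  set A := 2 * Λ + Λ ^ 2 + 1 with hA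
  have hA1 : 1 ≤ A := by rw [hA]; nlinarith [sq_nonneg Λ]
  refine ⟨C * A, min 1 (ε / (2 * A)), by positivity, by positivity, fun B hB L hL t ht0 ht => ?_⟩
  have ht1 : t ≤ 1 := ht.trans (min_le_left _ _)
  have htε : t * A < ε := by
    have := ht.trans (min_le_right _ _)
    rw [le_div_iff₀ (by positivity)] at this
    nlinarith
  obtain ⟨ι, -, h⟩ := stretch_eq_sqrt_det B hB
  rw [h L t]
  have hι : ‖ι.toContinuousLinearMap‖ ≤ 1 := ι.norm_toContinuousLinearMap_le
  have hι' : ‖ι.toContinuousLinearMap.adjoint‖ ≤ 1 := by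
    rwa [LinearIsometryEquiv.norm_map]
  have hLa : ‖L.adjoint‖ ≤ Λ := by rwa [LinearIsometryEquiv.norm_map]
  have hsand : ∀ N : V →L[ℝ] V,
      ‖ι.toContinuousLinearMap.adjoint ∘L N ∘L ι.toContinuousLinearMap‖ ≤ ‖N‖ := by
    intro N
    calc _ ≤ ‖ι.toContinuousLinearMap.adjoint‖ * (‖N‖ * ‖ι.toContinuousLinearMap‖) :=
          (ContinuousLinearMap.opNorm_comp_le _ _).trans
            (mul_le_mul_of_nonneg_left (ContinuousLinearMap.opNorm_comp_le _ _) (norm_nonneg _))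
      _ ≤ 1 * (‖N‖ * 1) := by gcongr
      _ = ‖N‖ := by ring
  have hX := (hsand (L + L.adjoint)).trans (norm_add_le _ _)
  have hY := (hsand (L.adjoint ∘L L)).trans (ContinuousLinearMap.opNorm_comp_le _ _)
  set X := ι.toContinuousLinearMap.adjoint ∘L (L + L.adjoint) ∘L ι.toContinuousLinearMap
  set Y := ι.toContinuousLinearMap.adjoint ∘L (L.adjoint ∘L L) ∘L ι.toContinuousLinearMap
  have hX' : ‖X‖ ≤ 2 * Λ := by linarith
  have hY' : ‖Y‖ ≤ Λ ^ 2 := by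
    calc _ ≤ _ := hY
      _ ≤ Λ * Λ := by gcongr
      _ = _ := by ring
  have hn : ‖t • X + t ^ 2 • Y‖ ≤ t * A := by
    calc _ ≤ ‖t • X‖ + ‖t ^ 2 • Y‖ := norm_add_le _ _
      _ = t * ‖X‖ + t ^ 2 * ‖Y‖ := by
        rw [norm_smul, norm_smul, Real.norm_of_nonneg ht0, Real.norm_of_nonneg (by positivity)]
      _ ≤ t * (2 * Λ) + t * Λ ^ 2 := by
        have : t ^ 2 ≤ t := by nlinarith
        gcongr
      _ ≤ t * A := by rw [hA]; nlinarith
  have := hball (y := 1 + (t • X + t ^ 2 • Y)) (by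
    rw [dist_eq_norm, add_sub_cancel_left]; exact hn.trans_lt htε)
  simp only [add_sub_cancel_left, Real.norm_eq_abs] at this
  have h1 : √(ContinuousLinearMap.det (1 : U →L[ℝ] U)) = 1 := by simp [ContinuousLinearMap.det]
  rw [h1] at this
  refine this.trans ?_
  rw [mul_assoc, mul_comm A]
  gcongr

end Stretch

/-! ### Comparison of measures -/

section Measure

/-- If `u` is more contracting than `v` on `s`, up to the factor `K`, then the Hausdorff measure
of `u(s)` is at most `K ^ d` times that of `v(s)`. -/
theorem euclideanHausdorffMeasure_image_le {X Y Z : Type*} [EMetricSpace Y] [MeasurableSpace Y]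
    [BorelSpace Y] [EMetricSpace Z] [MeasurableSpace Z] [BorelSpace Z] {u : X → Y} {v : X → Z}
    {s : Set X} {K : ℝ≥0} (h : ∀ x ∈ s, ∀ y ∈ s, edist (u x) (u y) ≤ K * edist (v x) (v y))
    (d : ℕ) : μHE[d] (u '' s) ≤ (K : ℝ≥0∞) ^ d * μHE[d] (v '' s) := by
  rcases s.eq_empty_or_nonempty with rfl | ⟨x₀, hx₀⟩
  · simp
  have : Nonempty X := ⟨x₀⟩
  have hinv : ∀ x ∈ s, Function.invFunOn v s (v x) ∈ s ∧ v (Function.invFunOn v s (v x)) = v x :=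
    fun x hx => ⟨Function.invFunOn_mem ⟨x, hx, rfl⟩, Function.invFunOn_eq ⟨x, hx, rfl⟩⟩
  have hLip : LipschitzOnWith K (u ∘ Function.invFunOn v s) (v '' s) := by
    rintro _ ⟨x, hx, rfl⟩ _ ⟨y, hy, rfl⟩
    have := h _ (hinv x hx).1 _ (hinv y hy).1
    rwa [(hinv x hx).2, (hinv y hy).2] at this
  -- `v` need not be injective on `s`, but by `h` points with equal `v`-values have equal
  -- `u`-values, so the chosen right inverse loses nothing.
  have himg : (u ∘ Function.invFunOn v s) '' (v '' s) = u '' s := by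
    rw [image_image]
    refine image_congr fun x hx => ?_
    have := h _ (hinv x hx).1 _ hx
    rw [(hinv x hx).2, edist_self, mul_zero] at this
    exact edist_le_zero.mp this
  have := hLip.hausdorffMeasure_image_le (d := d) (by positivity)
  rw [himg, ENNReal.rpow_natCast] at this
  simp_rw [Measure.euclideanHausdorffMeasure_def, Measure.smul_apply, ENNReal.smul_def, smul_eq_mul]
  calc _ ≤ _ := mul_le_mul_right this _
    _ = _ := by ring

/-- Local comparability of measures with constants close to `1` implies comparability. -/
theorem measure_le_of_locally_le {X : Type*} [TopologicalSpace X] [CompactSpace X]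
    [MeasurableSpace X] [BorelSpace X] {μ ν : Measure X} (m : ℕ)
    (h : ∀ K : ℝ≥0, 1 < K → ∀ x, ∃ u ∈ 𝓝 x, ∀ s ⊆ u, MeasurableSet s →
      μ s ≤ (K : ℝ≥0∞) ^ m * ν s) : μ ≤ ν := by
  refine Measure.le_iff.mpr fun s hs => ?_
  have key : ∀ K : ℝ≥0, 1 < K → μ s ≤ (K : ℝ≥0∞) ^ m * ν s := by
    intro K hK
    -- The estimate survives unions, since a set inside `o ∪ v` splits measurably into its parts
    -- inside and outside the open set `o`; compactness extends it to the whole space.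
    have hind : ∃ u ∈ 𝓝ˢ (univ : Set X), ∀ s ⊆ u, MeasurableSet s →
        μ s ≤ (K : ℝ≥0∞) ^ m * ν s := by
      refine isCompact_univ.induction_on (p := fun A => ∃ u ∈ 𝓝ˢ A, ∀ s ⊆ u, MeasurableSet s →
        μ s ≤ (K : ℝ≥0∞) ^ m * ν s) ?_ ?_ ?_ ?_
      · exact ⟨∅, by simp, fun s hs _ => by simp [subset_empty_iff.mp hs]⟩
      · rintro A B hAB ⟨u, hu, h'⟩
        exact ⟨u, nhdsSet_mono hAB hu, h'⟩
      · rintro A B ⟨u, hu, hu'⟩ ⟨v, hv, hv'⟩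
        obtain ⟨o, ho, hAo, hou⟩ := mem_nhdsSet_iff_exists.mp hu
        refine ⟨o ∪ v, ?_, fun s hs hsm => ?_⟩
        · rw [nhdsSet_union]
          exact ⟨mem_of_superset (ho.mem_nhdsSet.mpr hAo) subset_union_left,
            mem_of_superset hv subset_union_right⟩
        · rw [← measure_inter_add_sdiff s ho.measurableSet,
            ← measure_inter_add_sdiff (μ := ν) s ho.measurableSet, mul_add]
          refine add_le_add (hu' _ (inter_subset_right.trans hou) (hsm.inter ho.measurableSet))
            (hv' _ ?_ (hsm.diff ho.measurableSet))
          rintro x ⟨hx, hxo⟩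
          exact (hs hx).resolve_left hxo
      · intro x _
        obtain ⟨u, hu, h'⟩ := h K hK x
        obtain ⟨o, hou, ho, hx⟩ := mem_nhds_iff.mp hu
        exact ⟨o, mem_nhdsWithin_of_mem_nhds (ho.mem_nhds hx), o, ho.mem_nhdsSet_self,
          fun s hs => h' s (hs.trans hou)⟩
    obtain ⟨u, hu, h'⟩ := hind
    exact h' s ((subset_univ s).trans (subset_of_mem_nhdsSet hu)) hs
  -- The factor tends to 1, which is nonzero, so the limit is valid even when `ν s` is infinite.
  have hT : Tendsto (fun K : ℝ≥0 => (K : ℝ≥0∞) ^ m * ν s) (𝓝[>] 1) (𝓝 (1 ^ m * ν s)) := by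
    refine ENNReal.Tendsto.mul_const ?_ (Or.inl (by simp))
    refine ENNReal.Tendsto.pow ?_
    exact (ENNReal.tendsto_coe.mpr tendsto_id).mono_left nhdsWithin_le_nhds
  rw [one_pow, one_mul] at hT
  exact ge_of_tendsto hT (eventually_nhdsWithin_of_forall fun K hK => key K hK)

end Measure

/-- A map that is `C^1` within a convex set is strictly differentiable there. -/
theorem exists_lipschitzOnWith_sub_fderivWithin {E F : Type*} [NormedAddCommGroup E]
    [NormedSpace ℝ E] [NormedAddCommGroup F] [NormedSpace ℝ F] {u : E → F} {s : Set E} {x : E}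
    (hu : ContDiffWithinAt ℝ 1 u s x) (hs : Convex ℝ s) (hd : UniqueDiffOn ℝ s) (hx : x ∈ s)
    {c : ℝ≥0} (hc : 0 < c) :
    ∃ t ∈ 𝓝[s] x, LipschitzOnWith c (fun y => u y - fderivWithin ℝ u s x y) t := by
  -- Mean value inequality: the derivative of the difference is continuous within `s` and vanishes
  -- at `x`.
  refine hs.exists_nhdsWithin_lipschitzOnWith_of_hasFDerivWithinAt_of_nnnorm_lt
    (f' := fun y => fderivWithin ℝ u s y - fderivWithin ℝ u s x) ?_ ?_ c (by simpa using hc)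
  · have := hu.eventually (by simp)
    rw [insert_eq_of_mem hx] at this
    filter_upwards [this] with y hy
    exact (hy.differentiableWithinAt one_ne_zero).hasFDerivWithinAt.sub
      (fderivWithin ℝ u s x).hasFDerivWithinAt
  · exact ((hu.fderivWithin_right hd (m := 0) (by simp) hx).continuousWithinAt).sub
      continuousWithinAt_const

/-! ### Volume densities and the local geometry of embeddings -/

section Manifold

variable {n : ℕ} [NeZero n] {M : Type*} [TopologicalSpace M]
  [ChartedSpace (EuclideanHalfSpace n) M]

/-- The differential as a map on the model space `ℝⁿ`. -/
def coordDiffl (φ : M → Amb n) (p : M) : EuclideanSpace ℝ (Fin n) →L[ℝ] Amb n :=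
  diffl φ p

/-- The ratio of the volume densities which the metrics induced by `ψ` and by `φ` define. -/
def relJac (φ ψ : M → Amb n) (p : M) : ℝ :=
  LinearMap.normDet (coordDiffl ψ p : EuclideanSpace ℝ (Fin n) →ₗ[ℝ] Amb n) /
    LinearMap.normDet (coordDiffl φ p : EuclideanSpace ℝ (Fin n) →ₗ[ℝ] Amb n)

theorem IsEmb.coordDiffl_injective {φ : M → Amb n} (hφ : IsEmb φ) (p : M) :
    Function.Injective (coordDiffl φ p) := hφ.immersion p

theorem IsEmb.normDet_pos {φ : M → Amb n} (hφ : IsEmb φ) (p : M) :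
    0 < LinearMap.normDet (coordDiffl φ p : EuclideanSpace ℝ (Fin n) →ₗ[ℝ] Amb n) :=
  PreShape.normDet_pos (hφ.coordDiffl_injective p)

theorem IsEmb.relJac_pos {φ ψ : M → Amb n} (hφ : IsEmb φ) (hψ : IsEmb ψ) (p : M) :
    0 < relJac φ ψ p :=
  div_pos (hψ.normDet_pos p) (hφ.normDet_pos p)

theorem IsEmb.relJac_mul {φ ψ χ : M → Amb n} (hφ : IsEmb φ) (hψ : IsEmb ψ) (p : M) :
    relJac φ ψ p * relJac ψ χ p = relJac φ χ p := by
  have h1 := (hφ.normDet_pos p).ne'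
  have h2 := (hψ.normDet_pos p).ne'
  unfold relJac
  field_simp

theorem IsEmb.mdifferentiableAt {φ : M → Amb n} (hφ : IsEmb φ) (p : M) :
    MDifferentiableAt (𝓡∂ n) 𝓘(ℝ, Amb n) φ p :=
  hφ.smooth.mdifferentiable (by simp) p

/-- In the chart at `x₀`, the differential of `ψ` depends continuously on the point, and arises
by composition with a change of coordinates that does not depend on `ψ`. -/
theorem exists_continuousAt_coordDiffl_comp [IsManifold (𝓡∂ n) ∞ M] (x₀ : M) :
    ∃ T : M → EuclideanSpace ℝ (Fin n) →L[ℝ] EuclideanSpace ℝ (Fin n),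
      (∀ᶠ x in 𝓝 x₀, LinearMap.det (T x : EuclideanSpace ℝ (Fin n) →ₗ[ℝ] _) ≠ 0) ∧
      ∀ ψ : M → Amb n, ContMDiff (𝓡∂ n) 𝓘(ℝ, Amb n) ∞ ψ →
        ContinuousAt (fun x => coordDiffl ψ x ∘L T x) x₀ := by
  refine ⟨fun x => tangentCoordChange (𝓡∂ n) x₀ x x, ?_, fun ψ hψ => ?_⟩
  · filter_upwards [extChartAt_source_mem_nhds (I := 𝓡∂ n) x₀] with x hx
    have hx' := mem_extChartAt_source (I := 𝓡∂ n) x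
    -- The reverse coordinate change is a left inverse, so the determinant cannot vanish.
    have h : (tangentCoordChange (𝓡∂ n) x x₀ x ∘L tangentCoordChange (𝓡∂ n) x₀ x x) =
        ContinuousLinearMap.id ℝ (EuclideanSpace ℝ (Fin n)) := by
      ext1 v
      rw [ContinuousLinearMap.comp_apply, tangentCoordChange_comp ⟨⟨hx, hx'⟩, hx⟩,
        tangentCoordChange_self hx]
      rfl
    intro h0
    have h1 := congrArg (fun Z : EuclideanSpace ℝ (Fin n) →L[ℝ] EuclideanSpace ℝ (Fin n) => LinearMap.det
      (Z : EuclideanSpace ℝ (Fin n) →ₗ[ℝ] EuclideanSpace ℝ (Fin n))) h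
    simp only [ContinuousLinearMap.toLinearMap_comp, LinearMap.det_comp, h0, mul_zero] at h1
    simp at h1
  · have h := (hψ.contMDiffAt (x := x₀)).mfderiv_const (m := 0) (by simp)
    refine h.continuousAt.congr ?_
    filter_upwards [(chartAt (EuclideanHalfSpace n) x₀).open_source.mem_nhds
      (mem_chart_source _ x₀)] with x hx
    have hy : ψ x ∈ (chartAt (Amb n) (ψ x₀)).source := by
      rw [chartAt_self_eq]
      exact mem_univ _
    -- Coordinate changes of the tangent bundle of the target are the identity, so only the change
    -- in the source remains.
    refine (inTangentCoordinates_eq (I := 𝓡∂ n) (I' := 𝓘(ℝ, Amb n)) id ψ (coordDiffl ψ) hx hy).trans ?_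
    rw [tangentBundleCore_coordChange_model_space]
    rfl

/-- A single density refers to the preferred chart at each point and may jump with it. In the
quotient the common factor `|det T|` cancels. -/
theorem IsEmb.continuous_relJac [IsManifold (𝓡∂ n) ∞ M] {φ ψ : M → Amb n} (hφ : IsEmb φ) (hψ : IsEmb ψ) :
    Continuous (relJac φ ψ) := by
  refine continuous_iff_continuousAt.mpr fun x₀ => ?_
  obtain ⟨T, hT, hc⟩ := exists_continuousAt_coordDiffl_comp (n := n) x₀
  have hn : ∀ {χ : M → Amb n}, IsEmb χ → ContinuousAt (fun x => LinearMap.normDet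
      (coordDiffl χ x ∘L T x : EuclideanSpace ℝ (Fin n) →ₗ[ℝ] Amb n)) x₀ :=
    fun hχ => continuous_normDet.continuousAt.comp (hc _ hχ.smooth)
  have hmul : ∀ (χ : M → Amb n) (x : M), LinearMap.normDet
      (coordDiffl χ x ∘L T x : EuclideanSpace ℝ (Fin n) →ₗ[ℝ] Amb n) =
      LinearMap.normDet (coordDiffl χ x : EuclideanSpace ℝ (Fin n) →ₗ[ℝ] Amb n) *
        |LinearMap.det (T x : EuclideanSpace ℝ (Fin n) →ₗ[ℝ] _)| := fun χ x =>
    normDet_comp_endo _ _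
  refine ((hn hψ).div (hn hφ) ?_).congr ?_
  · rw [hmul]
    exact mul_ne_zero (hφ.normDet_pos _).ne' (abs_ne_zero.mpr hT.self_of_nhds)
  · filter_upwards [hT] with x hx
    rw [Pi.div_apply, hmul, hmul, mul_div_mul_right _ _ (abs_ne_zero.mpr hx)]
    rfl

/-- Near `p₀`, an embedding is bi-Lipschitz equivalent, with constant close to `1`, to its
differential at `p₀` in the chart at `p₀`. -/
theorem IsEmb.exists_nhds_edist_le {ψ : M → Amb n} (hψ : IsEmb ψ) (p₀ : M) {K : ℝ≥0}
    (hK : 1 < K) : ∃ u ∈ 𝓝 p₀, u ⊆ (extChartAt (𝓡∂ n) p₀).source ∧ ∀ p ∈ u, ∀ q ∈ u,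
      edist (ψ p) (ψ q) ≤ K * edist (coordDiffl ψ p₀ (extChartAt (𝓡∂ n) p₀ p))
        (coordDiffl ψ p₀ (extChartAt (𝓡∂ n) p₀ q)) ∧
      edist (coordDiffl ψ p₀ (extChartAt (𝓡∂ n) p₀ p))
        (coordDiffl ψ p₀ (extChartAt (𝓡∂ n) p₀ q)) ≤ K * edist (ψ p) (ψ q) := by
  set e := extChartAt (𝓡∂ n) p₀
  have hB : coordDiffl ψ p₀ = fderivWithin ℝ (ψ ∘ e.symm) (range (𝓡∂ n)) (e p₀) := by
    exact (hψ.mdifferentiableAt p₀).mfderiv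
  have hsm : ContDiffWithinAt ℝ 1 (ψ ∘ e.symm) (range (𝓡∂ n)) (e p₀) := by
    have := (contMDiffAt_iff.mp (hψ.smooth p₀)).2
    exact this.of_le (by norm_cast)
  obtain ⟨β, hβ, hanti⟩ := LinearMap.exists_antilipschitzWith
    (coordDiffl ψ p₀ : EuclideanSpace ℝ (Fin n) →ₗ[ℝ] Amb n)
    (LinearMap.ker_eq_bot.mpr (hψ.coordDiffl_injective p₀))
  have hK1 : (1 : ℝ) < K := hK
  have hη : 0 < (1 - 1 / K : ℝ) := by
    rw [sub_pos, div_lt_one (by linarith)]; exact hK1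
  -- `β` is an antilipschitz constant of the differential `B`, so this `c` makes the error at most
  -- `(1 - 1/K)` times the `B`-distance. The triangle inequality then gives the factors `2 - 1/K ≤
  -- K` and `1/K`.
  obtain ⟨c, hc⟩ : ∃ c : ℝ≥0, (c : ℝ) = (1 - 1 / K : ℝ) / β := ⟨⟨_, by positivity⟩, rfl⟩
  -- The model half space is convex with unique derivatives, so boundary points need no separate
  -- treatment.
  obtain ⟨t, ht, hLip⟩ := exists_lipschitzOnWith_sub_fderivWithin hsm (𝓡∂ n).convex_range
    (𝓡∂ n).uniqueDiffOn (mem_range_self _)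
    (c := c) (by rw [← NNReal.coe_pos, hc]; positivity)
  rw [← hB] at hLip
  set B := coordDiffl ψ p₀
  refine ⟨e ⁻¹' t ∩ e.source, ?_, inter_subset_right, fun p hp q hq => ?_⟩
  · refine inter_mem ?_ (extChartAt_source_mem_nhds p₀)
    rw [← map_extChartAt_nhds] at ht
    exact ht
  · have h1 := hLip.dist_le_mul _ hp.1 _ hq.1
    have h2 := hanti.le_mul_dist (e p) (e q)
    simp only [Function.comp_apply, e.left_inv hp.2, e.left_inv hq.2, hc] at h1
    have h3 : dist (ψ p - B (e p)) (ψ q - B (e q)) ≤ (1 - 1 / K) * dist (B (e p)) (B (e q)) := by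
      refine h1.trans ?_
      have hβ' : (0 : ℝ) < β := hβ
      calc (1 - 1 / K : ℝ) / β * dist (e p) (e q) ≤ (1 - 1 / K : ℝ) / β *
            (β * dist (B (e p)) (B (e q))) := by gcongr; exact h2
        _ = _ := by field_simp
    have h4 : ‖(ψ p - ψ q) - (B (e p) - B (e q))‖ ≤ (1 - 1 / K) * dist (B (e p)) (B (e q)) := by
      rw [dist_eq_norm] at h3
      rwa [sub_sub_sub_comm]
    have h5 := norm_sub_norm_le (ψ p - ψ q) (B (e p) - B (e q))
    have h6 := norm_sub_norm_le (B (e p) - B (e q)) (ψ p - ψ q)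
    rw [norm_sub_rev (B (e p) - B (e q))] at h6
    have hD := dist_nonneg (x := B (e p)) (y := B (e q))
    rw [dist_eq_norm] at h4 hD
    have hKK : (2 : ℝ) - 1 / K ≤ K := by
      have : (K : ℝ) - (2 - 1 / K) = (K - 1) ^ 2 / K := by field_simp; ring
      have h7 : 0 ≤ ((K : ℝ) - 1) ^ 2 / K := by positivity
      linarith
    have hKi : (K : ℝ) * (1 / K) = 1 := by field_simp
    have goal1 : dist (ψ p) (ψ q) ≤ K * dist (B (e p)) (B (e q)) := by
      rw [dist_eq_norm, dist_eq_norm]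
      nlinarith [mul_le_mul_of_nonneg_right hKK hD]
    have goal2 : dist (B (e p)) (B (e q)) ≤ K * dist (ψ p) (ψ q) := by
      rw [dist_eq_norm, dist_eq_norm]
      have h8 : 1 / K * ‖B (e p) - B (e q)‖ ≤ ‖ψ p - ψ q‖ := by linarith
      calc ‖B (e p) - B (e q)‖ = K * (1 / K * ‖B (e p) - B (e q)‖) := by
            rw [← mul_assoc, hKi, one_mul]
        _ ≤ _ := by gcongr
    rw [edist_dist, edist_dist, ← ENNReal.ofReal_coe_nnreal,
      ← ENNReal.ofReal_mul (by positivity), ← ENNReal.ofReal_mul (by positivity)]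
    exact ⟨ENNReal.ofReal_le_ofReal goal1, ENNReal.ofReal_le_ofReal goal2⟩

/-- Near `p₀`, the surface measure of `ψ(s)` is comparable, with constants close to `1`, to the
volume of `s` in the chart at `p₀`, times the volume density of `ψ` at `p₀`. -/
theorem IsEmb.exists_nhds_measure_image_le {ψ : M → Amb n} (hψ : IsEmb ψ) (p₀ : M) {K : ℝ≥0}
    (hK : 1 < K) : ∃ u ∈ 𝓝 p₀, u ⊆ (extChartAt (𝓡∂ n) p₀).source ∧ ∀ s ⊆ u,
      μHE[n] (ψ '' s) ≤ (K : ℝ≥0∞) ^ n * (ENNReal.ofReal (LinearMap.normDet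
        (coordDiffl ψ p₀ : EuclideanSpace ℝ (Fin n) →ₗ[ℝ] Amb n)) *
          volume (extChartAt (𝓡∂ n) p₀ '' s)) ∧
      ENNReal.ofReal (LinearMap.normDet
        (coordDiffl ψ p₀ : EuclideanSpace ℝ (Fin n) →ₗ[ℝ] Amb n)) *
          volume (extChartAt (𝓡∂ n) p₀ '' s) ≤ (K : ℝ≥0∞) ^ n * μHE[n] (ψ '' s) := by
  obtain ⟨u, hu, hus, h⟩ := hψ.exists_nhds_edist_le p₀ hK
  refine ⟨u, hu, hus, fun s hs => ?_⟩
  have hlin := LinearMap.euclideanHausdorffMeasure_image_eq_normDet_mul_volume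
    (coordDiffl ψ p₀ : EuclideanSpace ℝ (Fin n) →ₗ[ℝ] Amb n) (extChartAt (𝓡∂ n) p₀ '' s)
  rw [finrank_euclideanSpace_fin] at hlin
  rw [← hlin, image_image]
  exact ⟨euclideanHausdorffMeasure_image_le (fun x hx y hy => (h x (hs hx) y (hs hy)).1) n,
    euclideanHausdorffMeasure_image_le (fun x hx y hy => (h x (hs hx) y (hs hy)).2) n⟩

/-! ### Surface measures and the area formula -/

variable [MeasurableSpace M]

/-- The surface measure of `ψ(M)`, transported to `M`. -/
def surfaceMeasure (ψ : M → Amb n) : Measure M := Measure.comap ψ μHE[n]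

variable [CompactSpace M] [BorelSpace M]

theorem IsEmb.measurableEmbedding {ψ : M → Amb n} (hψ : IsEmb ψ) : MeasurableEmbedding ψ :=
  (hψ.smooth.continuous.isClosedEmbedding hψ.injective).measurableEmbedding

/-- By compactness local finiteness suffices. Near a point the measure is at most a constant times
the volume of a chart image, here kept inside a unit ball. -/
theorem IsEmb.isFiniteMeasure_surfaceMeasure {ψ : M → Amb n} (hψ : IsEmb ψ) :
    IsFiniteMeasure (surfaceMeasure ψ) := by
  have : IsLocallyFiniteMeasure (surfaceMeasure ψ) := by
    refine ⟨fun p₀ => ?_⟩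
    obtain ⟨u, hu, -, h⟩ := hψ.exists_nhds_measure_image_le p₀ (K := 2) one_lt_two
    refine ⟨u ∩ extChartAt (𝓡∂ n) p₀ ⁻¹' Metric.ball (extChartAt (𝓡∂ n) p₀ p₀) 1,
      inter_mem hu ((continuousAt_extChartAt p₀).preimage_mem_nhds
        (Metric.ball_mem_nhds _ one_pos)), ?_⟩
    rw [surfaceMeasure, hψ.measurableEmbedding.comap_apply]
    refine (h _ inter_subset_left).1.trans_lt ?_
    refine ENNReal.mul_lt_top (by simp) (ENNReal.mul_lt_top (by simp) ?_)
    refine (measure_mono ?_).trans_lt (measure_ball_lt_top (x := extChartAt (𝓡∂ n) p₀ p₀) (r := 1))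
    rintro _ ⟨x, hx, rfl⟩
    exact hx.2
  infer_instance

/-- The area formula for two embeddings of the same manifold. -/
theorem IsEmb.surfaceMeasure_eq_withDensity [IsManifold (𝓡∂ n) ∞ M] {φ ψ : M → Amb n} (hφ : IsEmb φ) (hψ : IsEmb ψ) :
    surfaceMeasure ψ =
      (surfaceMeasure φ).withDensity fun p => ENNReal.ofReal (relJac φ ψ p) := by
  have hcont := hφ.continuous_relJac hψ
  have hpos := hφ.relJac_pos hψ
  -- Comparing each surface measure with volume in the chart costs `K ^ n`, and replacing `relJac`
  -- by its value at `p₀` costs `K`: in total `K ^ (2 * n + 1)`.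
  have hmain : ∀ K : ℝ≥0, 1 < K → ∀ p₀, ∃ u ∈ 𝓝 p₀, ∀ s ⊆ u, MeasurableSet s →
      surfaceMeasure ψ s ≤ (K : ℝ≥0∞) ^ (2 * n + 1) *
        (surfaceMeasure φ).withDensity (fun p => ENNReal.ofReal (relJac φ ψ p)) s ∧
      (surfaceMeasure φ).withDensity (fun p => ENNReal.ofReal (relJac φ ψ p)) s ≤
        (K : ℝ≥0∞) ^ (2 * n + 1) * surfaceMeasure ψ s := by
    intro K hK p₀
    obtain ⟨u, hu, -, h⟩ := hφ.exists_nhds_measure_image_le p₀ hK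
    obtain ⟨v, hv, -, h'⟩ := hψ.exists_nhds_measure_image_le p₀ hK
    have hK1 : (1 : ℝ) < K := hK
    have h1 : ∀ᶠ p in 𝓝 p₀, relJac φ ψ p < K * relJac φ ψ p₀ :=
      hcont.continuousAt.eventually_lt continuousAt_const (by nlinarith [hpos p₀])
    have h2 : ∀ᶠ p in 𝓝 p₀, relJac φ ψ p₀ < K * relJac φ ψ p :=
      continuousAt_const.eventually_lt (hcont.continuousAt.const_mul _) (by nlinarith [hpos p₀])
    refine ⟨u ∩ v ∩ {p | relJac φ ψ p < K * relJac φ ψ p₀ ∧ relJac φ ψ p₀ < K * relJac φ ψ p},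
      inter_mem (inter_mem hu hv) (h1.and h2), fun s hs hsm => ?_⟩
    obtain ⟨hφ1, hφ2⟩ := h s fun x hx => (hs hx).1.1
    obtain ⟨hψ1, hψ2⟩ := h' s fun x hx => (hs hx).1.2
    have hd : ∀ c : ℝ≥0∞, ENNReal.ofReal (LinearMap.normDet
        (coordDiffl ψ p₀ : EuclideanSpace ℝ (Fin n) →ₗ[ℝ] Amb n)) * c =
        ENNReal.ofReal (relJac φ ψ p₀) * (ENNReal.ofReal (LinearMap.normDet
        (coordDiffl φ p₀ : EuclideanSpace ℝ (Fin n) →ₗ[ℝ] Amb n)) * c) := by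
      intro c
      rw [← mul_assoc, ← ENNReal.ofReal_mul (hpos p₀).le, relJac,
        div_mul_cancel₀ _ (hφ.normDet_pos p₀).ne']
    rw [hd] at hψ1 hψ2
    rw [← hφ.measurableEmbedding.comap_apply] at hφ1 hφ2
    rw [← hψ.measurableEmbedding.comap_apply] at hψ1 hψ2
    change surfaceMeasure φ s ≤ _ at hφ1
    change _ ≤ _ * surfaceMeasure φ s at hφ2
    change surfaceMeasure ψ s ≤ _ at hψ1
    change _ ≤ _ * surfaceMeasure ψ s at hψ2
    have hw1 : ENNReal.ofReal (relJac φ ψ p₀) * surfaceMeasure φ s ≤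
        K * (surfaceMeasure φ).withDensity (fun p => ENNReal.ofReal (relJac φ ψ p)) s := by
      rw [withDensity_apply _ hsm, ← setLIntegral_const, ← lintegral_const_mul _
        hcont.measurable.ennreal_ofReal]
      refine setLIntegral_mono' hsm fun p hp => ?_
      rw [← ENNReal.ofReal_coe_nnreal, ← ENNReal.ofReal_mul (by positivity)]
      exact ENNReal.ofReal_le_ofReal (hs hp).2.2.le
    have hw2 : (surfaceMeasure φ).withDensity (fun p => ENNReal.ofReal (relJac φ ψ p)) s ≤
        K * (ENNReal.ofReal (relJac φ ψ p₀) * surfaceMeasure φ s) := by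
      rw [withDensity_apply _ hsm, ← mul_assoc, ← setLIntegral_const]
      refine setLIntegral_mono' hsm fun p hp => ?_
      rw [← ENNReal.ofReal_coe_nnreal, ← ENNReal.ofReal_mul (by positivity)]
      exact ENNReal.ofReal_le_ofReal (hs hp).2.1.le
    constructor
    · calc _ ≤ _ := hψ1
        _ ≤ (K : ℝ≥0∞) ^ n * (ENNReal.ofReal (relJac φ ψ p₀) *
            ((K : ℝ≥0∞) ^ n * surfaceMeasure φ s)) := by gcongr
        _ = (K : ℝ≥0∞) ^ (2 * n) * (ENNReal.ofReal (relJac φ ψ p₀) * surfaceMeasure φ s) := by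
          ring
        _ ≤ _ := mul_le_mul_right hw1 _
        _ = _ := by ring
    · calc _ ≤ _ := hw2
        _ ≤ _ := mul_le_mul_right (mul_le_mul_right hφ1 _) _
        _ = (K : ℝ≥0∞) ^ (n + 1) * (ENNReal.ofReal (relJac φ ψ p₀) *
            (ENNReal.ofReal (LinearMap.normDet
              (coordDiffl φ p₀ : EuclideanSpace ℝ (Fin n) →ₗ[ℝ] Amb n)) *
              volume (extChartAt (𝓡∂ n) p₀ '' s))) := by ring
        _ ≤ _ := mul_le_mul_right hψ2 _
        _ = _ := by ring
  refine le_antisymm (measure_le_of_locally_le (2 * n + 1) fun K hK p => ?_)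
    (measure_le_of_locally_le (2 * n + 1) fun K hK p => ?_)
  · obtain ⟨u, hu, h⟩ := hmain K hK p
    exact ⟨u, hu, fun s hs hsm => (h s hs hsm).1⟩
  · obtain ⟨u, hu, h⟩ := hmain K hK p
    exact ⟨u, hu, fun s hs hsm => (h s hs hsm).2⟩

theorem IsEmb.integrable_of_continuous {ψ : M → Amb n} (hψ : IsEmb ψ) {h : M → ℝ}
    (hh : Continuous h) : Integrable h (surfaceMeasure ψ) := by
  have := hψ.isFiniteMeasure_surfaceMeasure
  exact hh.integrable_of_hasCompactSupport (HasCompactSupport.of_compactSpace h)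

theorem IsEmb.integral_range {ψ : M → Amb n} (hψ : IsEmb ψ) (h : Amb n → ℝ) :
    ∫ s in range ψ, h s ∂(μHE[n] : Measure (Amb n)) = ∫ p, h (ψ p) ∂(surfaceMeasure ψ) := by
  rw [← hψ.measurableEmbedding.map_comap, hψ.measurableEmbedding.integral_map, surfaceMeasure]

theorem IsEmb.integrableOn_range_iff {ψ : M → Amb n} (hψ : IsEmb ψ) (h : Amb n → ℝ) :
    IntegrableOn h (range ψ) μHE[n] ↔ Integrable (fun p => h (ψ p)) (surfaceMeasure ψ) := by
  rw [IntegrableOn, ← hψ.measurableEmbedding.map_comap,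
    hψ.measurableEmbedding.integrable_map_iff, surfaceMeasure]
  rfl

theorem IsEmb.integral_surfaceMeasure [IsManifold (𝓡∂ n) ∞ M] {φ ψ : M → Amb n} (hφ : IsEmb φ) (hψ : IsEmb ψ)
    (h : M → ℝ) : ∫ p, h p ∂(surfaceMeasure ψ) =
      ∫ p, h p * relJac φ ψ p ∂(surfaceMeasure φ) := by
  rw [hφ.surfaceMeasure_eq_withDensity hψ, integral_withDensity_eq_integral_toReal_smul
    (hφ.continuous_relJac hψ).measurable.ennreal_ofReal (by simp)]
  refine integral_congr_ae (Eventually.of_forall fun p => ?_)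
  simp only [ENNReal.toReal_ofReal (hφ.relJac_pos hψ p).le, smul_eq_mul]
  ring

end Manifold

/-! ### Determinants in oriented orthonormal frames -/

section Frames

variable {n : ℕ} {V : Type*} [NormedAddCommGroup V] [InnerProductSpace ℝ V]

/-- With `T` sending the standard basis to `b`, the map `B T` sends an orthonormal basis to an
orthonormal family, so its Gram determinant is 1. -/
theorem normDet_mul_abs_det_eq_one (B : EuclideanSpace ℝ (Fin n) →ₗ[ℝ] V)
    (b : Module.Basis (Fin n) ℝ (EuclideanSpace ℝ (Fin n))) (h : Orthonormal ℝ fun i => B (b i)) :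
    B.normDet * |(EuclideanSpace.basisFun (Fin n) ℝ).toBasis.det b| = 1 := by
  set e := EuclideanSpace.basisFun (Fin n) ℝ
  let T : EuclideanSpace ℝ (Fin n) →ₗ[ℝ] EuclideanSpace ℝ (Fin n) := e.toBasis.constr ℝ b
  have hT : ∀ i, T (e i) = b i := fun i => by
    have := e.toBasis.constr_basis ℝ b i
    rwa [OrthonormalBasis.coe_toBasis] at this
  have hdet : e.toBasis.det b = LinearMap.det T := by
    have h1 := e.toBasis.det_comp T e.toBasis
    have h2 : (T ∘ e.toBasis : Fin n → EuclideanSpace ℝ (Fin n)) = b := funext fun i => by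
      simp [hT]
    rwa [h2, Module.Basis.det_self, mul_one] at h1
  rw [hdet, ← normDet_comp_endo]
  have h3 := LinearMap.normDet_sq_eq_det_gram (B ∘ₗ T) e
  have h4 : Matrix.gram ℝ (fun i => (B ∘ₗ T) (e i)) = 1 := by
    ext i j
    simp only [Matrix.gram_apply, LinearMap.comp_apply, hT]
    rw [orthonormal_iff_ite.mp h i j, Matrix.one_apply]
  rw [h4, Matrix.det_one] at h3
  exact (pow_eq_one_iff_of_nonneg (LinearMap.normDet_nonneg _) two_ne_zero).mp (by exact_mod_cast h3)

/-- As `B b` is orthonormal, the matrix is the one expressing `a` in the basis `b`. Equal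
orientations make its determinant positive, and `normDet_mul_abs_det_eq_one` gives its modulus. -/
theorem det_inner_eq_normDet_div (A B : EuclideanSpace ℝ (Fin n) →ₗ[ℝ] V)
    (a b : Module.Basis (Fin n) ℝ (EuclideanSpace ℝ (Fin n)))
    (hA : Orthonormal ℝ fun i => A (a i)) (hB : Orthonormal ℝ fun i => B (b i))
    (hab : a.orientation = b.orientation) :
    (Matrix.of fun i j => ⟪B (a j), B (b i)⟫_ℝ).det = B.normDet / A.normDet := by
  have hA1 := normDet_mul_abs_det_eq_one A a hA
  have hB1 := normDet_mul_abs_det_eq_one B b hB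
  set e := (EuclideanSpace.basisFun (Fin n) ℝ).toBasis
  have hM : (Matrix.of fun i j => ⟪B (a j), B (b i)⟫_ℝ) = b.toMatrix a := by
    ext i j
    rw [Matrix.of_apply, Module.Basis.toMatrix_apply]
    conv_lhs => rw [← b.sum_repr (a j), map_sum]
    simp_rw [map_smul]
    rw [Orthonormal.inner_left_fintype hB]
    simp
  have hpos : 0 < b.det a := (b.orientation_eq_iff_det_pos a).mp hab.symm
  have hmul : e.det a = e.det b * b.det a := by
    simp only [Module.Basis.det_apply]
    rw [← Matrix.det_mul, Module.Basis.toMatrix_mul_toMatrix]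
  rw [hM, ← Module.Basis.det_apply]
  rw [hmul, abs_mul, abs_of_pos hpos] at hA1
  have hA0 : A.normDet ≠ 0 := fun h => by simp [h] at hA1
  have hb0 : |e.det b| ≠ 0 := fun h => by simp [h] at hB1
  rw [eq_div_iff hA0]
  have := hA1.trans hB1.symm
  apply mul_right_cancel₀ hb0
  linarith

end Frames

theorem perturb_zero {n : ℕ} {M : Type*} (φ : M → Amb n) (V : Amb n → Amb n) :
    perturb φ V 0 = φ := by
  funext p
  simp [perturb]

/-! ### Densities without frames, and perturbed embeddings -/

section Manifold

variable {n : ℕ} [NeZero n] {M : Type*} [TopologicalSpace M]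
  [ChartedSpace (EuclideanHalfSpace n) M]

/-- The shape is oriented by `ψ`, so its frame at `ψ p` is the image of a positive basis of the
tangent space of `M`, and both frames compare there with equal orientation. -/
theorem det_covDeriv_eq_relJac [IsManifold (𝓡∂ n) ∞ M] {incl ψ : M → Amb n}
    {o : ∀ p : M, Orientation ℝ (TangentSpace (𝓡∂ n) p) (Fin n)} {p : M}
    {τ : Fin n → ∀ q : M, TangentSpace (𝓡∂ n) q} {σ : Fin n → Amb n → Amb n}
    (hτ : IsOrientedFrameNear incl o p τ) (hσ : IsOrientedShapeFrameNear ψ o p σ) :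
    (covDeriv ψ τ σ p).det = relJac incl ψ p := by
  obtain ⟨U, -, hpU, -, hU⟩ := hτ
  obtain ⟨horth, a, ha, hao⟩ := hU p hpU
  obtain ⟨U', -, hpU', -, hU'⟩ := hσ
  obtain ⟨horth', v, ⟨b, hb, hbo⟩, hv⟩ := hU' p hpU'
  have h1 : Orthonormal ℝ fun i => diffl incl p (a i) := by simpa only [ha] using horth
  have h2 : Orthonormal ℝ fun i => diffl ψ p (b i) := by simpa only [hb, hv] using horth'
  have h3 : covDeriv ψ τ σ p =
      Matrix.of fun i j => ⟪diffl ψ p (a j), diffl ψ p (b i)⟫_ℝ := by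
    ext i j
    simp only [covDeriv, Matrix.of_apply, ha, hb, hv]
  rw [h3]
  exact det_inner_eq_normDet_div (coordDiffl incl p : EuclideanSpace ℝ (Fin n) →ₗ[ℝ] Amb n)
    (coordDiffl ψ p : EuclideanSpace ℝ (Fin n) →ₗ[ℝ] Amb n) a b h1 h2 (hao.trans hbo.symm)

theorem IsEmb.density_apply [IsManifold (𝓡∂ n) ∞ M] [Nonempty M] {incl ψ : M → Amb n}
    {o : ∀ p : M, Orientation ℝ (TangentSpace (𝓡∂ n) p) (Fin n)} (hψ : IsEmb ψ) (g : M → ℝ)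
    {τ : M → Fin n → ∀ q : M, TangentSpace (𝓡∂ n) q} {σ : M → Fin n → Amb n → Amb n}
    (hτ : ∀ p, IsOrientedFrameNear incl o p (τ p))
    (hσ : ∀ p, IsOrientedShapeFrameNear ψ o p (σ p)) (p : M) :
    density g ψ τ σ (ψ p) = g p * (1 / relJac incl ψ p) := by
  unfold density
  rw [Function.leftInverse_invFun hψ.injective p]
  simp only [det_covDeriv_eq_relJac (hτ p) (hσ p)]

theorem IsEmb.tangentialDiv_apply [Nonempty M] {φ : M → Amb n} (hφ : IsEmb φ)
    (V : Amb n → Amb n) (p : M) :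
    tangentialDiv φ V (φ p) = LinearMap.trace ℝ (Amb n)
      ((fderiv ℝ V (φ p) ∘L (LinearMap.range (coordDiffl φ p :
        EuclideanSpace ℝ (Fin n) →ₗ[ℝ] Amb n)).starProjection : Amb n →L[ℝ] Amb n) :
          Amb n →ₗ[ℝ] Amb n) := by
  have h : shapeTangent φ (φ p) =
      LinearMap.range (coordDiffl φ p : EuclideanSpace ℝ (Fin n) →ₗ[ℝ] Amb n) := by
    unfold shapeTangent
    rw [Function.leftInverse_invFun hφ.injective p]
    rfl
  unfold tangentialDiv
  simp only [h]

theorem IsEmb.coordDiffl_perturb {φ : M → Amb n} (hφ : IsEmb φ) {V : Amb n → Amb n}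
    (hV : ContDiff ℝ ∞ V) (t : ℝ) (p : M) :
    coordDiffl (perturb φ V t) p = (1 + t • fderiv ℝ V (φ p)) ∘L coordDiffl φ p := by
  have hVd : DifferentiableAt ℝ V (φ p) := hV.differentiable (by simp) _
  have h1 : HasFDerivAt (fun x => x + t • V x) (1 + t • fderiv ℝ V (φ p)) (φ p) :=
    (hasFDerivAt_id (φ p)).add (hVd.hasFDerivAt.const_smul t)
  have h2 := h1.hasMFDerivAt.comp p (hφ.mdifferentiableAt p).hasMFDerivAt
  exact h2.mfderiv

theorem IsEmb.relJac_perturb {φ : M → Amb n} (hφ : IsEmb φ) {V : Amb n → Amb n}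
    (hV : ContDiff ℝ ∞ V) (t : ℝ) (p : M) :
    relJac φ (perturb φ V t) p = stretch (coordDiffl φ p) (fderiv ℝ V (φ p)) t := by
  rw [relJac, hφ.coordDiffl_perturb hV, stretch]

theorem IsEmb.exists_norm_fderiv_le [CompactSpace M] {φ : M → Amb n} (hφ : IsEmb φ)
    {V : Amb n → Amb n} (hV : ContDiff ℝ ∞ V) :
    ∃ Λ, 0 ≤ Λ ∧ ∀ p, ‖fderiv ℝ V (φ p)‖ ≤ Λ := by
  have hc : Continuous fun p => fderiv ℝ V (φ p) :=
    (hV.continuous_fderiv (by simp)).comp hφ.smooth.continuous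
  obtain ⟨Λ, hΛ⟩ := isCompact_univ.exists_bound_of_continuousOn hc.continuousOn
  exact ⟨max Λ 0, le_max_right _ _, fun p => (hΛ p (mem_univ p)).trans (le_max_left _ _)⟩

/-- `φ_t` is `φ` followed by `id + t V`. For small `t` the term `t V` is a strict contraction near
the shape, and so is its differential, so neither injectivity nor immersivity is lost. -/
theorem IsEmbRel.eventually_perturb [CompactSpace M] {incl φ : M → Amb n}
    (hφ : IsEmbRel incl φ) {V : Amb n → Amb n} (hV : V ∈ directions φ) :
    ∀ᶠ t in 𝓝[>] (0 : ℝ), IsEmbRel incl (perturb φ V t) := by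
  obtain ⟨hVs, hV0⟩ := hV
  obtain ⟨Λ, hΛ0, hΛ⟩ := hφ.toIsEmb.exists_norm_fderiv_le hVs
  obtain ⟨R, hR⟩ := (isCompact_range hφ.smooth.continuous).isBounded.subset_closedBall 0
  -- The Lipschitz constant is taken on a ball because the shape itself need not be convex.
  obtain ⟨K, hK⟩ := hVs.contDiffOn.exists_lipschitzOnWith (by simp) (convex_closedBall (0 : Amb n) R)
    (isCompact_closedBall _ _)
  have ht1 : ∀ᶠ t in 𝓝[>] (0 : ℝ), t * Λ < 1 := by
    have : Tendsto (fun t : ℝ => t * Λ) (𝓝 0) (𝓝 (0 * Λ)) := tendsto_id.mul_const Λ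
    rw [zero_mul] at this
    exact (this.mono_left nhdsWithin_le_nhds).eventually_lt_const one_pos
  have ht2 : ∀ᶠ t : ℝ in 𝓝[>] (0 : ℝ), t * K < 1 := by
    have : Tendsto (fun t : ℝ => t * K) (𝓝 0) (𝓝 (0 * K)) := tendsto_id.mul_const (K : ℝ)
    rw [zero_mul] at this
    exact (this.mono_left nhdsWithin_le_nhds).eventually_lt_const one_pos
  filter_upwards [ht1, ht2, self_mem_nhdsWithin] with t hΛt hKt (ht : 0 < t)
  refine ⟨⟨?_, ?_, ?_⟩, ?_⟩
  · have h : ContDiff ℝ ∞ fun x => x + t • V x := contDiff_id.add (hVs.const_smul t)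
    exact h.contMDiff.comp hφ.smooth
  · intro p q hpq
    refine hφ.injective ?_
    have h1 : φ p - φ q = t • (V (φ q) - V (φ p)) := by
      have h2 : φ p + t • V (φ p) = φ q + t • V (φ q) := hpq
      rw [smul_sub, sub_eq_sub_iff_add_eq_add, h2, add_comm]
    have h3 := hK.dist_le_mul _ (hR ⟨q, rfl⟩) _ (hR ⟨p, rfl⟩)
    have h4 : dist (φ p) (φ q) ≤ t * K * dist (φ p) (φ q) := by
      calc dist (φ p) (φ q) = t * dist (V (φ q)) (V (φ p)) := by
            rw [dist_eq_norm, h1, norm_smul, Real.norm_of_nonneg ht.le, dist_eq_norm]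
        _ ≤ t * (K * dist (φ q) (φ p)) := by gcongr
        _ = _ := by rw [dist_comm]; ring
    have h5 : dist (φ p) (φ q) ≤ 0 := by
      by_contra! h
      nlinarith
    exact dist_le_zero.mp h5
  · intro p
    change Function.Injective (coordDiffl (perturb φ V t) p)
    rw [hφ.toIsEmb.coordDiffl_perturb hVs]
    have hinj : Function.Injective (1 + t • fderiv ℝ V (φ p) : Amb n →L[ℝ] Amb n) := by
      refine (injective_iff_map_eq_zero _).mpr fun x hx => ?_
      have h1 : x = -(t • fderiv ℝ V (φ p) x) := by
        refine eq_neg_of_add_eq_zero_left ?_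
        simpa using hx
      have h2 : ‖x‖ ≤ t * Λ * ‖x‖ := by
        calc ‖x‖ = t * ‖fderiv ℝ V (φ p) x‖ := by
              conv_lhs => rw [h1]
              rw [norm_neg, norm_smul, Real.norm_of_nonneg ht.le]
          _ ≤ t * (Λ * ‖x‖) := by
              gcongr
              exact (fderiv ℝ V (φ p)).le_of_opNorm_le (hΛ p) x
          _ = _ := by ring
      have h3 : ‖x‖ ≤ 0 := by
        by_contra! h
        nlinarith
      exact norm_le_zero_iff.mp h3
    exact hinj.comp (hφ.coordDiffl_injective p)
  · intro p hp
    rw [perturb, hV0 p hp, smul_zero, add_zero, hφ.boundary_fixed p hp]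

end Manifold

/-! ### Calculus of the scalar integrand -/

section Real

/-- Here `r` is the stretch, `F` the transported target and `ρ` the density at `t = 0`. The
`d`-terms combine as `(ρ - F)² - 2 ρ (ρ - F) = -(ρ² - F²)`. -/
theorem hasDerivWithinAt_sq_div_sub_mul {r F : ℝ → ℝ} {ρ d m : ℝ} {s : Set ℝ}
    (hr : HasDerivWithinAt r d s 0) (hF : HasDerivWithinAt F m s 0) (hr0 : r 0 = 1) :
    HasDerivWithinAt (fun t => (ρ / r t - F t) ^ 2 * r t)
      (-2 * ((1 / 2) * (ρ ^ 2 - F 0 ^ 2) * d + (ρ - F 0) * m)) s 0 := by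
  have h := ((((hasDerivWithinAt_const (0 : ℝ) s ρ).fun_div hr (by simp [hr0])).fun_sub
    hF).fun_pow 2).fun_mul hr
  refine h.congr_deriv ?_
  simp only [hr0]
  ring

/-- This supplies the constant that dominates the difference quotients. -/
theorem abs_sq_div_sub_mul_sub_le {ρ f r F R K C t : ℝ} (hρ : |ρ| ≤ R) (hf : |f| ≤ R)
    (hr : |r - 1| ≤ K * t) (hr2 : 1 / 2 ≤ r) (hF : |F - f| ≤ C * t) (hK : 0 ≤ K) (hC : 0 ≤ C)
    (ht0 : 0 ≤ t) (ht1 : t ≤ 1) :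
    |(ρ / r - F) ^ 2 * r - (ρ - f) ^ 2| ≤
      (2 * R ^ 2 * K + 2 * R * C + C * (2 * R + C) * (1 + K) + R ^ 2 * K) * t := by
  have hR : 0 ≤ R := (abs_nonneg _).trans hρ
  have hr0 : 0 < r := by linarith
  have hKt : K * t ≤ K := by nlinarith
  have hCt : C * t ≤ C := by nlinarith
  have hr1 : |r| ≤ 1 + K := by
    rw [abs_of_pos hr0]
    linarith [le_abs_self (r - 1)]
  have hinv : |1 / r| ≤ 2 := by
    rw [abs_of_pos (by positivity), div_le_iff₀ hr0]
    linarith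
  have hsum : |F + f| ≤ 2 * R + C := by
    have : F + f = (F - f) + 2 * f := by ring
    rw [this]
    refine (abs_add_le _ _).trans ?_
    rw [abs_mul, abs_two]
    linarith
  -- Every summand contains `r - 1` or `F - f`, hence a factor `t` in its bound.
  have heq : (ρ / r - F) ^ 2 * r - (ρ - f) ^ 2 =
      -(ρ ^ 2 * (r - 1) * (1 / r)) + -(2 * ρ * (F - f)) + (F - f) * (F + f) * r +
        f ^ 2 * (r - 1) := by
    field_simp
    ring
  rw [heq]
  have a1 : |-(ρ ^ 2 * (r - 1) * (1 / r))| ≤ R ^ 2 * (K * t) * 2 := by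
    rw [abs_neg, abs_mul, abs_mul, abs_pow]
    gcongr
  have a2 : |-(2 * ρ * (F - f))| ≤ 2 * R * (C * t) := by
    rw [abs_neg, abs_mul, abs_mul, abs_two]
    gcongr
  have a3 : |(F - f) * (F + f) * r| ≤ C * t * (2 * R + C) * (1 + K) := by
    rw [abs_mul, abs_mul]
    gcongr
  have a4 : |f ^ 2 * (r - 1)| ≤ R ^ 2 * (K * t) := by
    rw [abs_mul, abs_pow]
    gcongr
  calc _ ≤ _ := abs_add_le _ _
    _ ≤ |-(ρ ^ 2 * (r - 1) * (1 / r))| + |-(2 * ρ * (F - f))| + |(F - f) * (F + f) * r| +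
        |f ^ 2 * (r - 1)| := by
      gcongr
      exact (abs_add_le _ _).trans (by gcongr; exact abs_add_le _ _)
    _ ≤ _ := by linarith

end Real

/-! ### Differentiating the tracking functional -/

section TrackingFunctional

/-- The trace is a bounded functional in finite dimension and an orthogonal projection has norm at
most 1. -/
theorem exists_abs_tangentialDiv_le (n : ℕ) [NeZero n] : ∃ c : ℝ, 0 ≤ c ∧ ∀ {M : Type*}
    [TopologicalSpace M] [ChartedSpace (EuclideanHalfSpace n) M] [Nonempty M]
    (φ : M → Amb n) (V : Amb n → Amb n) (x : Amb n),
    |tangentialDiv φ V x| ≤ c * ‖fderiv ℝ V x‖ := by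
  let T : (Amb n →L[ℝ] Amb n) →L[ℝ] ℝ := LinearMap.toContinuousLinearMap
    (LinearMap.trace ℝ (Amb n) ∘ₗ ContinuousLinearMap.coeLM ℝ)
  refine ⟨‖T‖, norm_nonneg T, fun φ V x => ?_⟩
  calc |tangentialDiv φ V x| = ‖T (fderiv ℝ V x ∘L (shapeTangent φ x).starProjection)‖ := rfl
    _ ≤ ‖T‖ * ‖fderiv ℝ V x ∘L (shapeTangent φ x).starProjection‖ := T.le_opNorm _
    _ ≤ ‖T‖ * (‖fderiv ℝ V x‖ * ‖(shapeTangent φ x).starProjection‖) := by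
      gcongr
      exact ContinuousLinearMap.opNorm_comp_le _ _
    _ ≤ ‖T‖ * (‖fderiv ℝ V x‖ * 1) := by
      gcongr
      exact Submodule.starProjection_norm_le _
    _ = _ := by rw [mul_one]

variable {n : ℕ} [NeZero n] {M : Type*} [TopologicalSpace M]
  [ChartedSpace (EuclideanHalfSpace n) M]

theorem tangentialDiv_add [Nonempty M] (φ : M → Amb n) {V W : Amb n → Amb n}
    (hV : ContDiff ℝ ∞ V) (hW : ContDiff ℝ ∞ W) (x : Amb n) :
    tangentialDiv φ (V + W) x = tangentialDiv φ V x + tangentialDiv φ W x := by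
  unfold tangentialDiv
  rw [fderiv_add (hV.differentiable (by simp) _) (hW.differentiable (by simp) _),
    ContinuousLinearMap.add_comp, ContinuousLinearMap.toLinearMap_add, map_add]

theorem tangentialDiv_smul [Nonempty M] (φ : M → Amb n) (c : ℝ) {V : Amb n → Amb n}
    (hV : ContDiff ℝ ∞ V) (x : Amb n) :
    tangentialDiv φ (c • V) x = c * tangentialDiv φ V x := by
  unfold tangentialDiv
  rw [fderiv_const_smul (hV.differentiable (by simp) _), ContinuousLinearMap.smul_comp,
    ContinuousLinearMap.toLinearMap_smul, map_smul, smul_eq_mul]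

/-- The integrand of the tracking functional at `ψ`, pulled back to `M` and written as a density
with respect to the surface measure of `φ`. -/
def paramIntegrand (incl φ : M → Amb n) (g : M → ℝ) (f : (M → Amb n) → Amb n → ℝ)
    (ψ : M → Amb n) (p : M) : ℝ :=
  (g p * (1 / relJac incl φ p) / relJac φ ψ p - f ψ (ψ p)) ^ 2 * relJac φ ψ p

section Tracking

variable [IsManifold (𝓡∂ n) ∞ M]
  {incl : M → Amb n} (hincl : IsEmb incl)
  {o : ∀ p : M, Orientation ℝ (TangentSpace (𝓡∂ n) p) (Fin n)}
  {g : M → ℝ} (hg : ContMDiff (𝓡∂ n) 𝓘(ℝ, ℝ) ∞ g)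
  {f : (M → Amb n) → Amb n → ℝ}
  (hf : ∀ ψ, IsEmbRel incl ψ → ContMDiff (𝓡∂ n) 𝓘(ℝ, ℝ) ∞ (fun p => f ψ (ψ p)))
  {τ : M → Fin n → ∀ q : M, TangentSpace (𝓡∂ n) q}
  (hτ : ∀ p, IsOrientedFrameNear incl o p (τ p))
  {σ : (M → Amb n) → M → Fin n → Amb n → Amb n}
  (hσ : ∀ ψ, IsEmbRel incl ψ → ∀ p, IsOrientedShapeFrameNear ψ o p (σ ψ p))
  {φ : M → Amb n} (hφ : IsEmbRel incl φ)

include hincl hg hφ in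
theorem continuous_relDensity : Continuous fun p => g p * (1 / relJac incl φ p) := by
  refine hg.continuous.mul (continuous_const.div (hincl.continuous_relJac hφ.toIsEmb) fun p => ?_)
  exact (hincl.relJac_pos hφ.toIsEmb p).ne'

include hincl hg hf hφ in
theorem continuous_paramIntegrand {ψ : M → Amb n} (hψ : IsEmbRel incl ψ) :
    Continuous (paramIntegrand incl φ g f ψ) := by
  have h1 := hφ.toIsEmb.continuous_relJac hψ.toIsEmb
  exact ((((continuous_relDensity hincl hg hφ).div h1
    fun p => (hφ.toIsEmb.relJac_pos hψ.toIsEmb p).ne').sub (hf ψ hψ).continuous).pow 2).mul h1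

variable [Nonempty M]

include hincl hφ hτ hσ in
-- By multiplicativity of `relJac`, the density of `ψ` is the density of `φ` divided by `relJac φ
-- ψ`.
theorem trackingIntegrand_apply {ψ : M → Amb n} (hψ : IsEmbRel incl ψ) (p : M) :
    trackingIntegrand g f τ σ ψ (ψ p) * relJac φ ψ p = paramIntegrand incl φ g f ψ p := by
  have h1 := (hφ.toIsEmb.relJac_pos hψ.toIsEmb p).ne'
  have h2 := (hincl.relJac_pos hφ.toIsEmb p).ne'
  rw [trackingIntegrand, hψ.toIsEmb.density_apply g hτ (hσ ψ hψ), paramIntegrand,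
    ← hincl.relJac_mul hφ.toIsEmb p (χ := ψ)]
  congr 3
  field_simp

variable [CompactSpace M]

include hincl hg hf hτ hσ hφ in
/-- The difference quotients of the pulled back integrand converge pointwise and are bounded. -/
theorem paramIntegrand_quotient {V : Amb n → Amb n} (hV : V ∈ directions φ)
    (hmat : HasMaterialDeriv f φ V) :
    (∀ p, Tendsto (fun t => (paramIntegrand incl φ g f (perturb φ V t) p -
        paramIntegrand incl φ g f φ p) / t) (𝓝[>] 0)
      (𝓝 (-2 * derivIntegrand g f τ σ φ V (φ p)))) ∧
    ∃ D : ℝ, ∀ᶠ t in 𝓝[>] (0 : ℝ), ∀ p, |(paramIntegrand incl φ g f (perturb φ V t) p -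
        paramIntegrand incl φ g f φ p) / t| ≤ D := by
  have hφe := hφ.toIsEmb
  have hself : ∀ p, relJac φ φ p = 1 := fun p => div_self (hφe.normDet_pos p).ne'
  constructor
  · intro p
    have hr := (hasDerivAt_stretch (coordDiffl φ p) (hφe.coordDiffl_injective p)
      (fderiv ℝ V (φ p))).hasDerivWithinAt (s := Ici 0)
    rw [← hφe.tangentialDiv_apply, ← funext fun t => hφe.relJac_perturb hV.1 t p] at hr
    have hF := (hmat.exists_at (φ p) ⟨p, rfl⟩).hasDerivWithinAt
    have h := hasDerivWithinAt_sq_div_sub_mul (ρ := g p * (1 / relJac incl φ p)) hr hF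
      (by rw [perturb_zero, hself])
    rw [hasDerivWithinAt_iff_tendsto_slope, Ici_sdiff_left] at h
    have hval : derivIntegrand g f τ σ φ V (φ p) = (1 / 2) * ((g p * (1 / relJac incl φ p)) ^ 2 -
        f φ (φ p) ^ 2) * tangentialDiv φ V (φ p) +
        (g p * (1 / relJac incl φ p) - f φ (φ p)) * materialDeriv f φ V (φ p) := by
      rw [derivIntegrand, hφe.density_apply g hτ (hσ φ hφ)]
    rw [hval]
    simp only [perturb_zero, zero_smul, add_zero] at h
    refine h.congr fun t => ?_
    rw [slope_def_field, sub_zero]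
    simp only [perturb_zero, zero_smul, add_zero]
    rfl
  · obtain ⟨C, hC⟩ := hmat.bounded
    obtain ⟨Λ, hΛ0, hΛ⟩ := hφe.exists_norm_fderiv_le hV.1
    obtain ⟨K, δ, hK, hδ, hstr⟩ :=
      exists_abs_stretch_sub_one_le (EuclideanSpace ℝ (Fin n)) (Amb n) Λ hΛ0
    obtain ⟨R₁, hR₁⟩ := isCompact_univ.exists_bound_of_continuousOn
      (continuous_relDensity hincl hg hφ).continuousOn
    obtain ⟨R₂, hR₂⟩ := isCompact_univ.exists_bound_of_continuousOn (hf φ hφ).continuous.continuousOn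
    set R := max R₁ R₂
    refine ⟨2 * R ^ 2 * K + 2 * R * |C| + |C| * (2 * R + |C|) * (1 + K) + R ^ 2 * K, ?_⟩
    -- The first two bounds on `t` serve the integrand and stretch estimates; the third gives `K t ≤
    -- 1/2`, hence a stretch of at least `1/2`, with `K + 1` in place of `K` to allow `K = 0`.
    have hsmall : ∀ᶠ t in 𝓝[>] (0 : ℝ), t < min (min 1 δ) (1 / (2 * (K + 1))) :=
      (eventually_lt_nhds (by positivity)).filter_mono nhdsWithin_le_nhds
    filter_upwards [hC, hsmall, self_mem_nhdsWithin] with t hCt hts (ht : 0 < t) p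
    obtain ⟨⟨ht1, htδ⟩, htK⟩ := by simpa only [lt_min_iff] using hts
    have hs := hstr (coordDiffl φ p) (hφe.coordDiffl_injective p) _ (hΛ p) t ht.le htδ.le
    rw [← hφe.relJac_perturb hV.1] at hs
    have hKt : K * t ≤ 1 / 2 := by
      rw [lt_div_iff₀ (by positivity)] at htK
      nlinarith
    have hb := abs_sq_div_sub_mul_sub_le (ρ := g p * (1 / relJac incl φ p)) (f := f φ (φ p))
      (F := f (perturb φ V t) (perturb φ V t p)) (R := R) (C := |C|)
      ((hR₁ p (mem_univ p)).trans (le_max_left _ _))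
      ((hR₂ p (mem_univ p)).trans (le_max_right _ _)) hs
      (by linarith [neg_abs_le (relJac φ (perturb φ V t) p - 1)])
      ((hCt (φ p) ⟨p, rfl⟩).trans (by gcongr; exact le_abs_self C)) hK (abs_nonneg C) ht.le ht1.le
    rw [abs_div, abs_of_pos ht, div_le_iff₀ ht]
    simpa only [paramIntegrand, hself, div_one, mul_one] using hb

variable [MeasurableSpace M] [BorelSpace M]

include hincl hφ hτ hσ in
-- After this change of variables the measure no longer depends on `ψ`, so only the integrand has to
-- be differentiated.
theorem trackingFunctional_eq_integral {ψ : M → Amb n} (hψ : IsEmbRel incl ψ) :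
    trackingFunctional g f τ σ ψ =
      (1 / 2) * ∫ p, paramIntegrand incl φ g f ψ p ∂(surfaceMeasure φ) := by
  rw [trackingFunctional, hψ.toIsEmb.integral_range, hφ.toIsEmb.integral_surfaceMeasure hψ.toIsEmb]
  simp_rw [trackingIntegrand_apply hincl hτ hσ hφ hψ]

include hincl hg hf hτ hσ in
theorem integrableOn_trackingIntegrand {ψ : M → Amb n} (hψ : IsEmbRel incl ψ) :
    IntegrableOn (trackingIntegrand g f τ σ ψ) (range ψ) μHE[n] := by
  rw [hψ.toIsEmb.integrableOn_range_iff]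
  refine hψ.toIsEmb.integrable_of_continuous ?_
  simp_rw [trackingIntegrand, hψ.toIsEmb.density_apply g hτ (hσ ψ hψ)]
  exact ((continuous_relDensity hincl hg hψ).sub (hf ψ hψ).continuous).pow 2

include hincl hg hf hτ hσ hφ in
theorem integrable_derivIntegrand_and_tendsto {V : Amb n → Amb n} (hV : V ∈ directions φ)
    (hmat : HasMaterialDeriv f φ V) :
    Integrable (fun p => derivIntegrand g f τ σ φ V (φ p)) (surfaceMeasure φ) ∧
    Tendsto (fun t => (trackingFunctional g f τ σ (perturb φ V t) -
      trackingFunctional g f τ σ φ) / t) (𝓝[>] 0) (𝓝 (derivFormula g f τ σ φ V)) := by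
  classical
  have hfin := hφ.toIsEmb.isFiniteMeasure_surfaceMeasure
  obtain ⟨hlim, D, hD⟩ := paramIntegrand_quotient hincl hg hf hτ hσ hφ hV hmat
  have hemb := hφ.eventually_perturb hV
  set Q : ℝ → M → ℝ := fun t p => (paramIntegrand incl φ g f (perturb φ V t) p -
    paramIntegrand incl φ g f φ p) / t with hQ
  have hQc : ∀ t, IsEmbRel incl (perturb φ V t) → Continuous (Q t) := fun t ht =>
    ((continuous_paramIntegrand hincl hg hf hφ ht).sub
      (continuous_paramIntegrand hincl hg hf hφ hφ)).div_const t
  have hbound : ∀ p, |-2 * derivIntegrand g f τ σ φ V (φ p)| ≤ D := fun p =>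
    le_of_tendsto (hlim p).abs (hD.mono fun t ht => ht p)
  have hmeas : AEStronglyMeasurable (fun p => -2 * derivIntegrand g f τ σ φ V (φ p))
      (surfaceMeasure φ) := by
    -- The material derivative is only a pointwise limit, so measurability comes from the quotients.
    -- They are known to be continuous only when `φ_t` is an embedding; elsewhere they are replaced
    -- by 0.
    refine aestronglyMeasurable_of_tendsto_ae (𝓝[>] (0 : ℝ))
      (f := fun t p => if IsEmbRel incl (perturb φ V t) then Q t p else 0) (fun t => ?_)
      (Eventually.of_forall fun p => (hlim p).congr' ?_)
    · by_cases h : IsEmbRel incl (perturb φ V t)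
      · simp only [h, if_true]
        exact (hQc t h).aestronglyMeasurable
      · simp only [h, if_false]
        exact aestronglyMeasurable_const
    · filter_upwards [hemb] with t ht
      simp only [ht, if_true, hQ]
  have hint : Integrable (fun p => -2 * derivIntegrand g f τ σ φ V (φ p)) (surfaceMeasure φ) :=
    Integrable.of_bound hmeas D (Eventually.of_forall hbound)
  refine ⟨(hint.const_mul (-1 / 2)).congr (Eventually.of_forall fun p => ?_), ?_⟩
  · simp only
    ring
  have hT : Tendsto (fun t => ∫ p, Q t p ∂(surfaceMeasure φ)) (𝓝[>] 0)
      (𝓝 (∫ p, -2 * derivIntegrand g f τ σ φ V (φ p) ∂(surfaceMeasure φ))) := by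
    refine tendsto_integral_filter_of_dominated_convergence (fun _ => D) ?_ ?_
      (integrable_const D) (Eventually.of_forall hlim)
    · exact hemb.mono fun t ht => (hQc t ht).aestronglyMeasurable
    · exact hD.mono fun t ht => Eventually.of_forall ht
  have hT2 := hT.const_mul (1 / 2)
  rw [integral_const_mul] at hT2
  have hval : derivFormula g f τ σ φ V =
      1 / 2 * (-2 * ∫ p, derivIntegrand g f τ σ φ V (φ p) ∂(surfaceMeasure φ)) := by
    rw [derivFormula, hφ.toIsEmb.integral_range]
    ring
  rw [hval]
  refine hT2.congr' ?_
  filter_upwards [hemb] with t ht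
  rw [trackingFunctional_eq_integral hincl hτ hσ hφ ht,
    trackingFunctional_eq_integral hincl hτ hσ hφ hφ, hQ, integral_div, integral_sub
    (hφ.toIsEmb.integrable_of_continuous (continuous_paramIntegrand hincl hg hf hφ ht))
    (hφ.toIsEmb.integrable_of_continuous (continuous_paramIntegrand hincl hg hf hφ hφ))]
  ring

include hincl hg hf hτ hσ hφ in
-- The integrand is a combination of `div_Γ V` and the material derivative, both linear in `V`, with
-- coefficients bounded on the compact `M`; the total surface measure is finite.
theorem isBoundedLinear_derivFormula
    (hmat : ∀ V ∈ directions φ, HasMaterialDeriv f φ V)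
    (hlin : IsBoundedLinear (directions φ)
      (fun V (x : range φ) => materialDeriv f φ V x)) :
    IsBoundedLinear (directions φ) (fun V (_ : Unit) => derivFormula g f τ σ φ V) := by
  have hφe := hφ.toIsEmb
  have hfin := hφe.isFiniteMeasure_surfaceMeasure
  have hint : ∀ V ∈ directions φ,
      Integrable (fun p => derivIntegrand g f τ σ φ V (φ p)) (surfaceMeasure φ) := fun V hV =>
    (integrable_derivIntegrand_and_tendsto hincl hg hf hτ hσ hφ hV (hmat V hV)).1
  have hform : ∀ V, derivFormula g f τ σ φ V =
      -∫ p, derivIntegrand g f τ σ φ V (φ p) ∂(surfaceMeasure φ) := fun V => by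
    rw [derivFormula, hφe.integral_range]
  obtain ⟨hmlin, K, k, C, hK, hC⟩ := hlin
  refine ⟨⟨fun V W => ?_, fun c V => ?_⟩, ?_⟩
  · funext _
    have hpt : ∀ p, derivIntegrand g f τ σ φ (V + W : directions φ) (φ p) =
        derivIntegrand g f τ σ φ V (φ p) + derivIntegrand g f τ σ φ W (φ p) := by
      intro p
      have h1 : materialDeriv f φ (V + W : directions φ) (φ p) =
          materialDeriv f φ V (φ p) + materialDeriv f φ W (φ p) :=
        congrFun (hmlin.map_add V W) ⟨φ p, p, rfl⟩
      have h2 : tangentialDiv φ (V + W : directions φ) (φ p) =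
          tangentialDiv φ V (φ p) + tangentialDiv φ W (φ p) :=
        tangentialDiv_add φ V.2.1 W.2.1 (φ p)
      rw [derivIntegrand, h1, h2, derivIntegrand, derivIntegrand]
      ring
    simp only [Pi.add_apply]
    rw [hform, hform, hform, integral_congr_ae (Eventually.of_forall hpt),
      integral_add (hint V V.2) (hint W W.2)]
    ring
  · funext _
    have hpt : ∀ p, derivIntegrand g f τ σ φ (c • V : directions φ) (φ p) =
        c * derivIntegrand g f τ σ φ V (φ p) := by
      intro p
      have h1 : materialDeriv f φ (c • V : directions φ) (φ p) = c * materialDeriv f φ V (φ p) :=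
        congrFun (hmlin.map_smul c V) ⟨φ p, p, rfl⟩
      have h2 : tangentialDiv φ (c • V : directions φ) (φ p) = c * tangentialDiv φ V (φ p) :=
        tangentialDiv_smul φ c V.2.1 (φ p)
      rw [derivIntegrand, h1, h2, derivIntegrand]
      ring
    simp only [Pi.smul_apply, smul_eq_mul]
    rw [hform, hform, integral_congr_ae (Eventually.of_forall hpt), integral_const_mul]
    ring
  · obtain ⟨c, hc, htr⟩ := exists_abs_tangentialDiv_le n
    obtain ⟨R₁, hR₁⟩ := isCompact_univ.exists_bound_of_continuousOn
      (continuous_relDensity hincl hg hφ).continuousOn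
    obtain ⟨R₂, hR₂⟩ := isCompact_univ.exists_bound_of_continuousOn (hf φ hφ).continuous.continuousOn
    -- The divergence needs first derivatives on the shape, the material derivative those of order
    -- up to `k` on `K`.
    refine ⟨K ∪ range φ, max k 1, (1 / 2 * (R₁ ^ 2 + R₂ ^ 2) * c + (R₁ + R₂) * C) *
      (surfaceMeasure φ).real univ, hK.union (isCompact_range hφ.smooth.continuous),
      fun V hV B hB hVB _ => ?_⟩
    have hpt : ∀ p, ‖derivIntegrand g f τ σ φ V (φ p)‖ ≤
        (1 / 2 * (R₁ ^ 2 + R₂ ^ 2) * c + (R₁ + R₂) * C) * B := by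
      intro p
      have hm : |materialDeriv f φ V (φ p)| ≤ C * B :=
        hC V hV B hB (fun j hj x hx => hVB j (hj.trans (le_max_left _ _)) x (Or.inl hx))
          ⟨φ p, p, rfl⟩
      have hd : |tangentialDiv φ V (φ p)| ≤ c * B := by
        refine (htr φ V (φ p)).trans ?_
        gcongr
        rw [← norm_iteratedFDeriv_one]
        exact hVB 1 (le_max_right _ _) (φ p) (Or.inr ⟨p, rfl⟩)
      have h1 := hR₁ p (mem_univ p)
      have h2 := hR₂ p (mem_univ p)
      have hR₁0 := (norm_nonneg _).trans h1
      have hR₂0 := (norm_nonneg _).trans h2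
      rw [derivIntegrand, hφe.density_apply g hτ (hσ φ hφ)]
      calc _ ≤ ‖(1 / 2) * ((g p * (1 / relJac incl φ p)) ^ 2 - f φ (φ p) ^ 2) *
            tangentialDiv φ V (φ p)‖ +
            ‖(g p * (1 / relJac incl φ p) - f φ (φ p)) * materialDeriv f φ V (φ p)‖ :=
            norm_add_le _ _
        _ ≤ 1 / 2 * (R₁ ^ 2 + R₂ ^ 2) * (c * B) + (R₁ + R₂) * (C * B) := by
            rw [norm_mul, norm_mul, norm_mul]
            have h3 : ‖(g p * (1 / relJac incl φ p)) ^ 2 - f φ (φ p) ^ 2‖ ≤ R₁ ^ 2 + R₂ ^ 2 := by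
              refine (norm_sub_le _ _).trans ?_
              rw [norm_pow, norm_pow]
              gcongr
            have h4 : ‖g p * (1 / relJac incl φ p) - f φ (φ p)‖ ≤ R₁ + R₂ :=
              (norm_sub_le _ _).trans (add_le_add h1 h2)
            have h5 : ‖(1 / 2 : ℝ)‖ = 1 / 2 := by norm_num
            rw [h5]
            have hm' : ‖materialDeriv f φ V (φ p)‖ ≤ C * B := hm
            have hd' : ‖tangentialDiv φ V (φ p)‖ ≤ c * B := hd
            gcongr
        _ = _ := by ring
    change |derivFormula g f τ σ φ V| ≤ _
    rw [hform, abs_neg]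
    refine (norm_integral_le_of_norm_le_const (Eventually.of_forall hpt)).trans (le_of_eq ?_)
    ring

end Tracking

end TrackingFunctional

end PreShape

end

theorem theorem2p2 {n : ℕ} [NeZero n]
    {M : Type*} [TopologicalSpace M] [ChartedSpace (EuclideanHalfSpace n) M]
    [IsManifold (𝓡∂ n) ∞ M] [CompactSpace M] [PathConnectedSpace M]
    -- `M` is an oriented submanifold of `ℝ^{n+1}` with inclusion `incl`
    (incl : M → PreShape.Amb n) (hincl : PreShape.IsEmb incl)
    (o : ∀ p : M, Orientation ℝ (TangentSpace (𝓡∂ n) p) (Fin n))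
    (ho : PreShape.IsManifoldOrientation o)
    -- the initial density `g^M` and the targets `f_φ`
    (g : M → ℝ) (hg : ContMDiff (𝓡∂ n) 𝓘(ℝ, ℝ) ∞ g) (hgpos : ∀ p, 0 < g p)
    (f : (M → PreShape.Amb n) → PreShape.Amb n → ℝ)
    (hf : ∀ ψ, PreShape.IsEmbRel incl ψ →
      ContMDiff (𝓡∂ n) 𝓘(ℝ, ℝ) ∞ (fun p => f ψ (ψ p)))
    (hfpos : ∀ ψ, PreShape.IsEmbRel incl ψ → ∀ p, 0 < f ψ (ψ p))
    (hfshape : ∀ ψ, PreShape.IsEmbRel incl ψ → ∀ ρ : M ≃ₘ^∞⟮𝓡∂ n, 𝓡∂ n⟯ M,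
      PreShape.IsEmbRel incl (ψ ∘ ρ) → EqOn (f (ψ ∘ ρ)) (f ψ) (range ψ))
    (hfnorm : ∀ ψ, PreShape.IsEmbRel incl ψ →
      ∫ s in range ψ, f ψ s ∂(μHE[n] : Measure (PreShape.Amb n)) =
        ∫ s in range incl, g (Function.invFun incl s) ∂(μHE[n] : Measure (PreShape.Amb n)))
    -- oriented local orthonormal frames of `M` and of all the shapes `ψ(M)`
    (τ : M → Fin n → ∀ q : M, TangentSpace (𝓡∂ n) q)
    (hτ : ∀ p, PreShape.IsOrientedFrameNear incl o p (τ p))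
    (σ : (M → PreShape.Amb n) → M → Fin n → PreShape.Amb n → PreShape.Amb n)
    (hσ : ∀ ψ, PreShape.IsEmbRel incl ψ →
      ∀ p, PreShape.IsOrientedShapeFrameNear ψ o p (σ ψ p))
    -- the pre-shape `φ`, at which material derivatives of `f` exist
    (φ : M → PreShape.Amb n) (hφ : PreShape.IsEmbRel incl φ)
    (hmat : ∀ V ∈ PreShape.directions φ, PreShape.HasMaterialDeriv f φ V) :
    -- the functional is well defined
    (∀ ψ, PreShape.IsEmbRel incl ψ →
      IntegrableOn (PreShape.trackingIntegrand g f τ σ ψ) (range ψ) μHE[n]) ∧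
    -- the formula
    (∀ V ∈ PreShape.directions φ,
      IntegrableOn (PreShape.derivIntegrand g f τ σ φ V) (range φ) μHE[n] ∧
      PreShape.HasDirectionalDeriv incl (PreShape.trackingFunctional g f τ σ) φ V
        (PreShape.derivFormula g f τ σ φ V)) ∧
    -- linearity and boundedness in `V`
    (PreShape.IsBoundedLinear (PreShape.directions φ)
        (fun V (x : range φ) => PreShape.materialDeriv f φ V x) →
      PreShape.IsBoundedLinear (PreShape.directions φ)
        (fun V (_ : Unit) => PreShape.derivFormula g f τ σ φ V)) ∧
    -- independence of the frames
    (∀ (τ' : M → Fin n → ∀ q : M, TangentSpace (𝓡∂ n) q)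
      (σ' : (M → PreShape.Amb n) → M → Fin n → PreShape.Amb n → PreShape.Amb n),
      (∀ p, PreShape.IsOrientedFrameNear incl o p (τ' p)) →
      (∀ ψ, PreShape.IsEmbRel incl ψ →
        ∀ p, PreShape.IsOrientedShapeFrameNear ψ o p (σ' ψ p)) →
      ∀ V ∈ PreShape.directions φ,
        PreShape.derivFormula g f τ' σ' φ V = PreShape.derivFormula g f τ σ φ V) := by
  -- The Borel structure on `M` is auxiliary: it serves only to pull the surface measures back.
  let : MeasurableSpace M := borel M
  have : BorelSpace M := ⟨rfl⟩
  refine ⟨fun ψ hψ => PreShape.integrableOn_trackingIntegrand hincl hg hf hτ hσ hψ,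
    fun V hV => ?_,
    PreShape.isBoundedLinear_derivFormula hincl hg hf hτ hσ hφ hmat,
    fun τ' σ' hτ' hσ' V _ => ?_⟩
  · have h := PreShape.integrable_derivIntegrand_and_tendsto hincl hg hf hτ hσ hφ hV (hmat V hV)
    exact ⟨(hφ.toIsEmb.integrableOn_range_iff _).mpr h.1, hφ.eventually_perturb hV, h.2⟩
  · rw [PreShape.derivFormula, PreShape.derivFormula, hφ.toIsEmb.integral_range,
      hφ.toIsEmb.integral_range]
    -- Frames enter only through the density, which equals the same frame-free expression for both
    -- choices.
    simp_rw [PreShape.derivIntegrand, hφ.toIsEmb.density_apply g hτ' (hσ' φ hφ),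
      hφ.toIsEmb.density_apply g hτ (hσ φ hφ)]
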